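/- **Setting.** Let $\mathbb X$ be a measurable space and $(X_n,S_n)_{n\ge0}$ the canonical Markov chain on $\mathbb X\times\mathbb R^2$ with transition kernel $P$ satisfying $P((x,s);A\times C)=P((x,0);A\times(C-s))$ for all $x\in\mathbb X$, $s\in\mathbb R^2$, $A\subset\mathbb X$ measurable and $C\subset\mathbb R^2$ Borel. Let $\mathbb P_{(x,0)}$, resp. $\mathbb P_{(\mu,0)}$, be its law when $(X_0,S_0)=(x,0)$, resp. $(X_0,S_0)\sim\mu\otimes\delta_0$, and let $Q(x,A)=P((x,0);A\times\mathbb R^2)$. Let $\pi$ be a $Q$-invariant probability measure, and suppose that $S_1$ is $\mathbb P_{(\pi,0)}$-integrable with mean $0$. Let $\mathbb S$ be a closed subgroup of $\mathbb R^2$ that spans $\mathbb R^2$, with $\mathbb P_{(x,0)}(S_n\in\mathbb S)=1$ for all $x$ and $n$. For a subgroup $H$ of $\mathbb R^2$ put $H^*=\{s\in\mathbb R^2:\langle s,t\rangle\in2\pi\mathbb Z\ \ \forall t\in H\}$. Put $(Q(t)f)(x)=\mathbb E_{(x,0)}[e^{i\langle t,S_1\rangle}f(X_1)]$ for $t\in\mathbb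 R^2$. Let $\mathcal B,\widehat{\mathcal B}$ be complex Banach spaces of $\pi$-integrable complex functions on $\mathbb X$, or of classes modulo $\pi$ of such functions, with continuous inclusions $\mathcal B\subset\widehat{\mathcal B}\subset L^1(\pi)$ (in the natural sense: a function may be identified with its class if $\mathcal B$ consists of functions and $\widehat{\mathcal B}$ of classes). Suppose that $1\in\mathcal B$ and that $Q(t)$ acts as a bounded operator on $\mathcal B$ and on $\widehat{\mathcal B}$ for every $t$. Inequalities in (A4) hold everywhere if $\mathcal B$ consists of functions, and $\pi$-almost everywhere if it consists of classes. Denote by $r$ the spectral radius in $\mathcal L(\mathcal B)$ and by $r_{ess}(T)=\lim_n(\inf_{K\text{ compact}}\|T^n-K\|_{\mathcal B})^{1/n}$ the essential spectral radius. Assume: * (A1) $Q^n\to\pi(\cdot)1$ in $\mathcal L(\mathcal B)$. * (A2) For every $t$, $\|Q(t+h)-Q(t)\|_{\mathcal B,\widehat{\mathcal B}}\to0$ as $h\to0$. * (A3) For every compact $K\subset\mathbb R^2$ there are $\kappa\in(0,1)$ and $C\in(0,\infty)$ such that, for all $t\in K$, $r_{ess}(Q(t))\le\kappa$ and $\|Q(t)^nf\|_{\mathcal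 B}\le C\kappa^n\|f\|_{\mathcal B}+C\|f\|_{\widehat{\mathcal B}}$ for all $n\ge1$ and $f\in\mathcal B$. * (A4) For every $\lambda\in\mathbb C$ with $|\lambda|\ge1$ and every nonzero $f\in\mathcal B$: if $|\lambda|^n|f|\le Q^n|f|$ for all large $n$, then $|\lambda|=1$ and $|f|\le\pi(|f|)$. Further definitions: * *Decay*: for every compact $K\subset\mathbb R^2\setminus\mathbb S^*$ there is $\rho\in[0,1)$ with $\sup_{t\in K}\|Q(t)^n\|_{\mathcal B}=O(\rho^n)$. * $G=\{t\in\mathbb R^2: r(Q(t))=1\}$. * $(S_n)$ is *arithmetic in $\mathbb S$ w.r.t. $\mathcal B$* if there are $t\in\mathbb R^2\setminus\mathbb S^*$, $\lambda\in\mathbb C$ with $|\lambda|=1$ and $w\in\mathcal B$ such that, for $\pi$-a.e. $x$, $|w(x)|=1$ and, for all $n\ge1$, $e^{i\langle t,S_n\rangle}w(X_n)=\lambda^nw(x)$ $\mathbb P_{(x,0)}$-a.s. * $(S_n)$ is *sublattice in $\mathbb S$ with data* $(\mathbb S_0,\chi,(\beta_t)_{t\in\mathbb S_0^*})$ if $\mathbb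 S_0$ is a closed proper subgroup of $\mathbb S$, $\chi:\mathbb X\to\mathbb R^2$ is bounded and measurable, $\beta_t\in\mathbb R$, and, for $\pi$-a.e. $x$, for all $t\in\mathbb S_0^*$ and $n\ge1$, $\langle t,S_n+\chi(X_n)-\chi(x)\rangle\in n\beta_t+2\pi\mathbb Z$ $\mathbb P_{(x,0)}$-a.s. * (A5) There are $L:(0,\infty)\to(0,\infty)$ with $L(kx)/L(x)\to1$ as $x\to\infty$ for every $k>0$, and $A_n>0$ with $A_n^2\sim nL(A_n)$ and $\sum_nA_n^{-2}=\infty$, such that under $\mathbb P_{(\pi,0)}$ the sequence $S_n/A_n$ converges in distribution to a Gaussian law $\mathcal N(0,\Gamma)$ with $\Gamma$ positive definite. * (A6) There are no data with which $(S_n)$ is sublattice in $\mathbb S$. **Proposition.** Under these assumptions, including (A1)–(A4): 1. Decay holds $\iff G=\mathbb S^*\iff(S_n)$ is not arithmetic in $\mathbb S$ w.r.t. $\mathcal B$. 2. Suppose that $\mathbb S=\mathbb R^2$ or that $\mathcal B$ is dense in $L^1(\pi)$. If (A5) and (A6) hold, then Decay holds. 3. If $(S_n)$ is sublattice in $\mathbb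 S$ with data $(\mathbb S_0,\chi,(\beta_t))$ such that $e^{i\langle t,\chi(\cdot)\rangle}\in\mathcal B$ for every $t\in\mathbb R^2$, then Decay fails. -/

import Mathlib

open MeasureTheory ProbabilityTheory Filter Topology
open scoped ENNReal

noncomputable section

namespace MRW

/-- The Euclidean plane. -/
abbrev Plane : Type := EuclideanSpace ℝ (Fin 2)

section Chain

variable {X : Type*} [MeasurableSpace X]

/-- The additive property in the second component:
`P((x,s); A × B) = P((x,0); A × (B - s))`. -/
def IsAdditive (P : Kernel (X × Plane) (X × Plane)) : Prop :=
  ∀ (x : X) (s : Plane) (A : Set X) (B : Set Plane), MeasurableSet A → MeasurableSet B →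
    P (x, s) (A ×ˢ B) = P (x, 0) (A ×ˢ {y | y + s ∈ B})

/-- The transition kernel, seen as a function of the whole past up to time `n`. -/
def step (P : Kernel (X × Plane) (X × Plane)) (n : ℕ) :
    Kernel ((i : Finset.Iic n) → (fun _ : ℕ => X × Plane) i) (X × Plane) :=
  P.comap (fun h => h ⟨n, Finset.mem_Iic.2 le_rfl⟩) (measurable_pi_apply _)

instance (P : Kernel (X × Plane) (X × Plane)) [IsMarkovKernel P] (n : ℕ) :
    IsMarkovKernel (step P n) := by
  unfold step; infer_instance

/-- The law on the canonical space `(X × ℝ²)^ℕ` of the Markov chain with transition kernel `P` and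
initial distribution `ν`. -/
def law (P : Kernel (X × Plane) (X × Plane)) [IsMarkovKernel P] (ν : Measure (X × Plane)) :
    Measure (ℕ → X × Plane) :=
  Kernel.trajMeasure (X := fun _ => X × Plane) ν (step P)

instance (P : Kernel (X × Plane) (X × Plane)) [IsMarkovKernel P] (ν : Measure (X × Plane))
    [IsProbabilityMeasure ν] : IsProbabilityMeasure (law P ν) := by
  unfold law; infer_instance

/-- `ℙ_{(x,0)}`. -/
def lawFrom (P : Kernel (X × Plane) (X × Plane)) [IsMarkovKernel P] (x : X) :
    Measure (ℕ → X × Plane) :=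
  law P (Measure.dirac (x, 0))

/-- `ℙ_{(μ,0)}`, the law of the walk with initial distribution `μ ⊗ δ₀`. -/
def lawInit (P : Kernel (X × Plane) (X × Plane)) [IsMarkovKernel P] (μ : Measure X) :
    Measure (ℕ → X × Plane) :=
  law P (μ.prod (Measure.dirac 0))

instance (P : Kernel (X × Plane) (X × Plane)) [IsMarkovKernel P] (μ : Measure X)
    [IsProbabilityMeasure μ] : IsProbabilityMeasure (lawInit P μ) := by
  unfold lawInit; infer_instance

/-- The driving component `X_n` on the canonical space. -/
def drive (n : ℕ) (ω : ℕ → X × Plane) : X := (ω n).1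

/-- The additive component `S_n` on the canonical space. -/
def walk (n : ℕ) (ω : ℕ → X × Plane) : Plane := (ω n).2

/-- The transition kernel `Q(x, A) = P((x,0); A × ℝ²)` of the driving chain. -/
def driveKernel (P : Kernel (X × Plane) (X × Plane)) : Kernel X X :=
  (P.comap (fun x : X => (x, (0 : Plane))) (by fun_prop)).map Prod.fst

/-- `(Q^n g)(x)` for a nonnegative function `g`. -/
def kernelPow (Q : Kernel X X) (n : ℕ) (g : X → ℝ≥0∞) : X → ℝ≥0∞ :=
  (fun (u : X → ℝ≥0∞) (x : X) => ∫⁻ y, u y ∂(Q x))^[n] g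

/-- The function `Q(t) f`, that is `x ↦ 𝔼_{(x,0)}[exp(i⟨t,S₁⟩) f(X₁)]`; recall that `P((x,0);·)` is
the law of `(X₁,S₁)` under `ℙ_{(x,0)}`. -/
def fourierFun (P : Kernel (X × Plane) (X × Plane)) (t : Plane) (f : X → ℂ) (x : X) : ℂ :=
  ∫ z, Complex.exp (Complex.I * (inner ℝ t z.2 : ℝ)) * f z.1 ∂(P (x, 0))

end Chain

/-- The dual subgroup `H* = {s : ⟨s,t⟩ ∈ 2πℤ for all t ∈ H}`. -/
def dualSubgroup (H : AddSubgroup Plane) : AddSubgroup Plane where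
  carrier := {s | ∀ t ∈ H, ∃ k : ℤ, inner ℝ s t = 2 * Real.pi * k}
  zero_mem' := fun t _ => ⟨0, by simp⟩
  add_mem' := by
    intro a b ha hb t ht
    obtain ⟨k, hk⟩ := ha t ht
    obtain ⟨l, hl⟩ := hb t ht
    exact ⟨k + l, by rw [inner_add_left, hk, hl]; push_cast; ring⟩
  neg_mem' := by
    intro a ha t ht
    obtain ⟨k, hk⟩ := ha t ht
    exact ⟨-k, by rw [inner_neg_left, hk]; push_cast; ring⟩

section Spaces

variable {X : Type*} [MeasurableSpace X]

/-- A realization of the normed space `Y` as a space of `π`-integrable complex functions on `X`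
(`sense = ⊤`: equalities and inequalities hold everywhere) or as a space of classes modulo `π` of
such functions (`sense = ae π`: they hold `π`-almost everywhere). `rep f` is the function `f`,
respectively a measurable representative of the class `f`. -/
structure FunctionSpace (π : Measure X) (Y : Type*) [NormedAddCommGroup Y] [NormedSpace ℂ Y] where
  sense : Filter X
  sense_eq : sense = ⊤ ∨ sense = ae π
  rep : Y → X → ℂ
  measurable_rep : ∀ f, Measurable (rep f)
  integrable_rep : ∀ f, Integrable (rep f) π
  rep_add : ∀ f g, rep (f + g) =ᶠ[sense] rep f + rep g
  rep_smul : ∀ (c : ℂ) f, rep (c • f) =ᶠ[sense] c • rep f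
  rep_injective : ∀ f g, rep f =ᶠ[sense] rep g → f = g

namespace FunctionSpace

variable {π : Measure X} {Y : Type*} [NormedAddCommGroup Y] [NormedSpace ℂ Y]

/-- The function `h` (or its class modulo `π`) belongs to the space. -/
def Contains (F : FunctionSpace π Y) (h : X → ℂ) : Prop :=
  ∃ f : Y, F.rep f =ᶠ[F.sense] h

/-- The space is continuously included in `L¹(π)`. -/
def ContinuouslyInL1 (F : FunctionSpace π Y) : Prop :=
  ∃ d : ℝ, 0 < d ∧ ∀ f : Y, ∫ x, ‖F.rep f x‖ ∂π ≤ d * ‖f‖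

/-- The space is dense in `L¹(π)`. -/
def DenseInL1 (F : FunctionSpace π Y) : Prop :=
  ∀ h : X → ℂ, Integrable h π → ∀ ε : ℝ, 0 < ε → ∃ f : Y, ∫ x, ‖h x - F.rep f x‖ ∂π < ε

/-- The bounded operator `T` on the space is the Fourier operator `Q(t)`: each `Q(t) f` is given by
convergent integrals and coincides with `T f`. -/
def IsFourierOperator (F : FunctionSpace π Y) (P : Kernel (X × Plane) (X × Plane)) (t : Plane)
    (T : Y →L[ℂ] Y) : Prop :=
  ∀ f : Y, (∀ᶠ x in F.sense, Integrable (F.rep f) (driveKernel P x)) ∧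
    F.rep (T f) =ᶠ[F.sense] fourierFun P t (F.rep f)

/-- `J` is the inclusion of the first space into the second one. A space of functions may be
included in a space of classes, but not conversely. -/
def IsInclusion {Y' : Type*} [NormedAddCommGroup Y'] [NormedSpace ℂ Y']
    (F : FunctionSpace π Y) (F' : FunctionSpace π Y') (J : Y →L[ℂ] Y') : Prop :=
  F'.sense ≤ F.sense ∧ ∀ f : Y, F'.rep (J f) =ᶠ[F'.sense] F.rep f

end FunctionSpace

/-- The essential spectral radius `lim_n (inf_K ‖T^n - K‖)^{1/n}`, where `K` runs over the compact
endomorphisms (by submultiplicativity the limit exists, so that it is the upper limit). -/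
def essSpectralRadius {Y : Type*} [NormedAddCommGroup Y] [NormedSpace ℂ Y] (T : Y →L[ℂ] Y) :
    ℝ≥0∞ :=
  limsup (fun n : ℕ =>
    (⨅ K : {K : Y →L[ℂ] Y // IsCompactOperator K}, ‖T ^ n - K.1‖ₑ) ^ (1 / (n : ℝ))) atTop

variable {π : Measure X} {B : Type*} [NormedAddCommGroup B] [NormedSpace ℂ B]
  {Bh : Type*} [NormedAddCommGroup Bh] [NormedSpace ℂ Bh]

/-- (A1): strong ergodicity, `Q^n → π` in operator norm, where `π` stands for `f ↦ π(f) 1`. -/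
def A1 (F : FunctionSpace π B) (T : Plane → B →L[ℂ] B) : Prop :=
  ∃ E : B →L[ℂ] B, (∀ f, F.rep (E f) =ᶠ[F.sense] fun _ => ∫ y, F.rep f y ∂π) ∧
    Tendsto (fun n : ℕ => T 0 ^ n) atTop (𝓝 E)

/-- (A2): continuity of `t ↦ Q(t)` in the operator norm from `B` to the larger space. -/
def A2 (J : B →L[ℂ] Bh) (T : Plane → B →L[ℂ] B) : Prop :=
  ∀ t : Plane, Tendsto (fun h : Plane => ‖J ∘L (T (t + h) - T t)‖) (𝓝 0) (𝓝 0)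

/-- (A3): essential spectral radii and Doeblin-Fortet inequalities, uniformly on compact sets. -/
def A3 (J : B →L[ℂ] Bh) (T : Plane → B →L[ℂ] B) : Prop :=
  ∀ K : Set Plane, IsCompact K → ∃ κ C : ℝ, 0 < κ ∧ κ < 1 ∧ 0 < C ∧
    ∀ t ∈ K, essSpectralRadius (T t) ≤ ENNReal.ofReal κ ∧
      ∀ n : ℕ, 1 ≤ n → ∀ f : B, ‖(T t ^ n) f‖ ≤ C * κ ^ n * ‖f‖ + C * ‖J f‖

/-- (A4): if `|λ| ≥ 1`, `f ≠ 0` and `|λ|^n |f| ≤ Q^n |f|` for all large `n`, then `|λ| = 1` and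
`|f| ≤ π(|f|)`. -/
def A4 (F : FunctionSpace π B) (P : Kernel (X × Plane) (X × Plane)) : Prop :=
  ∀ (l : ℂ) (f : B), 1 ≤ ‖l‖ → f ≠ 0 →
    (∃ n₀ : ℕ, ∀ n ≥ n₀, ∀ᶠ x in F.sense,
      ENNReal.ofReal (‖l‖ ^ n * ‖F.rep f x‖)
        ≤ kernelPow (driveKernel P) n (fun y => ‖F.rep f y‖ₑ) x) →
    ‖l‖ = 1 ∧ ∀ᶠ x in F.sense, ‖F.rep f x‖ ≤ ∫ y, ‖F.rep f y‖ ∂π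

/-- (A5): a central limit theorem with a non-degenerate Gaussian limit, and normalizing constants
`A_n` such that `A_n² ∼ n L(A_n)` with `L` slowly varying at infinity and `∑ A_n⁻² = ∞`. -/
def A5 (P : Kernel (X × Plane) (X × Plane)) [IsMarkovKernel P] (π : Measure X)
    [IsProbabilityMeasure π] : Prop :=
  ∃ (L : ℝ → ℝ) (A : ℕ → ℝ) (Γ : Matrix (Fin 2) (Fin 2) ℝ),
    (∀ x, 0 < x → 0 < L x) ∧
    (∀ k, 0 < k → Tendsto (fun x => L (k * x) / L x) atTop (𝓝 1)) ∧
    (∀ n, 0 < A n) ∧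
    Tendsto (fun n : ℕ => A n ^ 2 / (n * L (A n))) atTop (𝓝 1) ∧
    ¬ Summable (fun n : ℕ => (A n ^ 2)⁻¹) ∧
    Γ.PosDef ∧
    TendstoInDistribution (fun (n : ℕ) (ω : ℕ → X × Plane) => (A n)⁻¹ • walk n ω) atTop
      (id : Plane → Plane) (fun _ => lawInit P π) (multivariateGaussian 0 Γ)

/-- The triple `(S₀, χ, β)` shows that `(S_n)` is sublattice in `S`: `S₀` is a proper closed
subgroup of `S`, `χ` is bounded and measurable, and for `π`-almost every `x`, for all `t ∈ S₀*` and
`n ≥ 1`, `⟨t, S_n + χ(X_n) - χ(x)⟩ ∈ n β_t + 2πℤ` holds `ℙ_{(x,0)}`-almost surely. -/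
def IsSublatticeTriple (P : Kernel (X × Plane) (X × Plane)) [IsMarkovKernel P] (π : Measure X)
    (S S₀ : AddSubgroup Plane) (χ : X → Plane) (β : dualSubgroup S₀ → ℝ) : Prop :=
  IsClosed (S₀ : Set Plane) ∧ S₀ < S ∧ Measurable χ ∧ (∃ C : ℝ, ∀ x, ‖χ x‖ ≤ C) ∧
    ∀ᵐ x ∂π, ∀ t : dualSubgroup S₀, ∀ n : ℕ, 1 ≤ n → ∀ᵐ ω ∂(lawFrom P x),
      ∃ k : ℤ, inner ℝ (t : Plane) (walk n ω + χ (drive n ω) - χ x) = n * β t + 2 * Real.pi * k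

/-- (A6): `(S_n)` is non-sublattice in `S`. -/
def A6 (P : Kernel (X × Plane) (X × Plane)) [IsMarkovKernel P] (π : Measure X)
    (S : AddSubgroup Plane) : Prop :=
  ¬ ∃ (S₀ : AddSubgroup Plane) (χ : X → Plane) (β : dualSubgroup S₀ → ℝ),
    IsSublatticeTriple P π S S₀ χ β

/-- `(S_n)` is arithmetic in `S` with respect to the space `B`. -/
def IsArithmetic (F : FunctionSpace π B) (P : Kernel (X × Plane) (X × Plane)) [IsMarkovKernel P]
    (S : AddSubgroup Plane) : Prop :=
  ∃ (t : Plane) (l : ℂ) (w : B), t ∉ dualSubgroup S ∧ ‖l‖ = 1 ∧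
    ∀ᵐ x ∂π, ‖F.rep w x‖ = 1 ∧ ∀ n : ℕ, 1 ≤ n → ∀ᵐ ω ∂(lawFrom P x),
      Complex.exp (Complex.I * (inner ℝ t (walk n ω) : ℝ)) * F.rep w (drive n ω)
        = l ^ n * F.rep w x

/-- For every compact `K ⊆ ℝ² \ S*` there is `ρ ∈ [0,1)` with `sup_{t ∈ K} ‖Q(t)^n‖ = O(ρ^n)`. -/
def GeometricDecay (T : Plane → B →L[ℂ] B) (S : AddSubgroup Plane) : Prop :=
  ∀ K : Set Plane, IsCompact K → (∀ t ∈ K, t ∉ dualSubgroup S) →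
    ∃ ρ : ℝ, 0 ≤ ρ ∧ ρ < 1 ∧ ∃ C : ℝ, ∀ᶠ n : ℕ in atTop, ∀ t ∈ K, ‖T t ^ n‖ ≤ C * ρ ^ n

end Spaces

end MRW

end

open MRW

/-! Everything rests on a dichotomy for each frequency t. Either `Q(t)` has spectral radius less
than one, or it has spectral radius one and there are a unimodular l and a w in B, with |w| = 1
almost everywhere, such that exp(i⟨t,S₁⟩) w(X₁) = l w(X₀): a phase (`IsPhase`). Since the essential
spectral radius is below one, a spectral value of modulus at least one yields an eigenvector f whose
eigenvalue has the same modulus. Then |λ||f| ≤ Q|f|, so (A4) makes |λ| = 1 and |f| constant, and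
equality in the triangle inequality turns the eigenvalue equation into the pathwise relation
(`spectralRadius_lt_one_or_exists_phase`).

Conversely, `Q(t)` contracts L¹(π). If an f in B is at L¹-distance less than one from a phase v,
then `Q(t)^n f` stays that close to `l^n v` and cannot tend to zero
(`IsPhase.not_spectralRadius_lt_one`). A spectral radius below one is moreover locally uniform in t,
by the Doeblin-Fortet inequality and the continuity into the larger space
(`exists_nhds_norm_pow_le`); compactness then gives decay. Claims 1 and 3 follow, the latter because
a proper closed subgroup S₀ of S has a dual strictly larger than that of S.

For claim 2, the frequencies with a phase form a group containing S*. If decay fails, this group is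
strictly larger, and a discrete group H with S* < H can be fitted inside it. This is immediate for S
= ℝ²; in the dense case it uses that the group is closed. The arguments of the phases attached to a
basis of H, paired with a dual family, give χ, and H* serves as S₀ (`exists_isSublatticeTriple`).
Pontryagin duality for closed subgroups of the plane is proved by hand. -/

noncomputable section

set_option linter.unusedSectionVars false

namespace MRW

/-! ### Discrete and closed subgroups of a Euclidean space -/

section Geometry

variable {E : Type*} [NormedAddCommGroup E]

/-- The nonzero elements of the subgroup `H` have norms bounded away from zero. -/
def HasGap (H : AddSubgroup E) : Prop := ∃ ε : ℝ, 0 < ε ∧ ∀ x ∈ H, ‖x‖ < ε → x = 0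

variable [InnerProductSpace ℝ E]

theorem zsmul_eq_zero_of_norm_lt {a : E} {m : ℤ} (h : ‖m • a‖ < ‖a‖) :
    m • a = 0 := by
  rw [← Int.cast_smul_eq_zsmul ℝ, norm_smul] at h
  have hm : ‖(m : ℝ)‖ < 1 := by nlinarith [norm_nonneg a]
  rw [Real.norm_eq_abs, ← Int.cast_abs] at hm
  have hm0 : m = 0 := Int.abs_lt_one_iff.1 (by exact_mod_cast hm)
  rw [hm0, zero_smul]

theorem hasGap_zmultiples {a : E} (ha : a ≠ 0) : HasGap (AddSubgroup.zmultiples a) := by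
  refine ⟨‖a‖, norm_pos_iff.2 ha, fun x hx hlt => ?_⟩
  obtain ⟨m, rfl⟩ := AddSubgroup.mem_zmultiples_iff.1 hx
  exact zsmul_eq_zero_of_norm_lt hlt

/-- Repeated halving of v enters the gap without reaching zero, so it leaves L; the first exponent
at which it does so is taken. -/
theorem HasGap.exists_half {L : AddSubgroup E} (hL : HasGap L) {v : E} (hv : v ∈ L) (hv0 : v ≠ 0) :
    ∃ c : ℝ, c • v ∉ L ∧ (2 : ℝ) • (c • v) ∈ L := by
  obtain ⟨ε, hε, hgap⟩ := hL
  have hex : ∃ k : ℕ, ((1 / 2 : ℝ) ^ k) • v ∉ L := by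
    by_contra! hall
    have hlim : Tendsto (fun k : ℕ => ‖((1 / 2 : ℝ) ^ k) • v‖) atTop (𝓝 0) := by
      have := ((tendsto_pow_atTop_nhds_zero_of_lt_one (r := (1 / 2 : ℝ)) (by norm_num)
        (by norm_num)).smul_const v).norm
      simpa using this
    obtain ⟨k, hk⟩ := (hlim.eventually (gt_mem_nhds hε)).exists
    have := hgap _ (hall k) hk
    simp [hv0] at this
  classical
  let k := Nat.find hex
  have hk : ((1 / 2 : ℝ) ^ k) • v ∉ L := Nat.find_spec hex
  refine ⟨(1 / 2 : ℝ) ^ k, hk, ?_⟩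
  obtain ⟨m, hm⟩ : ∃ m, k = m + 1 := by
    refine Nat.exists_eq_succ_of_ne_zero fun h0 => hk ?_
    simpa [h0] using hv
  have := Nat.find_min hex (m := m) (show m < k by omega)
  rw [not_not] at this
  rw [hm, smul_smul, pow_succ]
  convert this using 2
  ring

variable [FiniteDimensional ℝ E]

/-- The directions of the x_k accumulate at a unit vector a. The integer multiples ⌊c/‖x_k‖⌋ x_k lie
in H and approximate c a with an error controlled by ‖x_k‖, so closedness captures the whole line.
-/
theorem exists_line_of_tendsto_zero {H : AddSubgroup E} (hH : IsClosed (H : Set E)) {x : ℕ → E}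
    (hx : ∀ k, x k ∈ H) (hx0 : ∀ k, x k ≠ 0) (hlim : Tendsto x atTop (𝓝 0)) :
    ∃ (a : E) (φ : ℕ → ℕ), ‖a‖ = 1 ∧
      Tendsto (fun k => ‖x (φ k)‖⁻¹ • x (φ k)) atTop (𝓝 a) ∧ ∀ c : ℝ, c • a ∈ H := by
  have hsph : ∀ k, ‖x k‖⁻¹ • x k ∈ Metric.sphere (0 : E) 1 := fun k => by
    simp [norm_smul, hx0 k]
  obtain ⟨a, ha, φ, hφ, hφa⟩ := (isCompact_sphere (0 : E) 1).tendsto_subseq hsph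
  refine ⟨a, φ, by simpa using ha, hφa, fun c => ?_⟩
  have hmem : ∀ k, (⌊c * ‖x (φ k)‖⁻¹⌋ : ℤ) • x (φ k) ∈ H := fun k => H.zsmul_mem (hx _) _
  suffices hs : Tendsto (fun k => (⌊c * ‖x (φ k)‖⁻¹⌋ : ℤ) • x (φ k)) atTop (𝓝 (c • a)) from
    hH.mem_of_tendsto hs (Eventually.of_forall hmem)
  have hn : Tendsto (fun k => ‖x (φ k)‖) atTop (𝓝 0) := by
    simpa using (hlim.comp hφ.tendsto_atTop).norm
  have hfl : Tendsto (fun k => (⌊c * ‖x (φ k)‖⁻¹⌋ : ℝ) * ‖x (φ k)‖) atTop (𝓝 c) := by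
    rw [tendsto_iff_norm_sub_tendsto_zero]
    refine squeeze_zero (fun _ => norm_nonneg _) (fun k => ?_) hn
    have hp : 0 < ‖x (φ k)‖ := norm_pos_iff.2 (hx0 _)
    rw [Real.norm_eq_abs, abs_le]
    have h1 := Int.floor_le (c * ‖x (φ k)‖⁻¹)
    have h2 := Int.lt_floor_add_one (c * ‖x (φ k)‖⁻¹)
    have h3 : c * ‖x (φ k)‖⁻¹ * ‖x (φ k)‖ = c := by field_simp
    constructor <;> nlinarith
  have := hfl.smul hφa
  refine this.congr fun k => ?_
  have hp : ‖x (φ k)‖ ≠ 0 := norm_ne_zero_iff.2 (hx0 _)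
  simp only [Function.comp, smul_smul]
  rw [mul_assoc, mul_inv_cancel₀ hp, mul_one, Int.cast_smul_eq_zsmul]

/-- V consists of all lines contained in H. If elements of H outside V came arbitrarily close to V,
their components orthogonal to V would lie in H and tend to zero, producing a line of H that is both
in V and orthogonal to it. -/
theorem exists_subspace_of_isClosed {H : AddSubgroup E} (hH : IsClosed (H : Set E)) :
    ∃ V : Submodule ℝ E, (∀ v ∈ V, v ∈ H) ∧
      ∃ ε : ℝ, 0 < ε ∧ ∀ h ∈ H, ‖h - V.starProjection h‖ < ε → h ∈ V := by
  let V : Submodule ℝ E :=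
    { carrier := {v | ∀ c : ℝ, c • v ∈ H}
      add_mem' := fun ha hb c => by rw [smul_add]; exact H.add_mem (ha c) (hb c)
      zero_mem' := fun c => by simp
      smul_mem' := fun d v hv c => by rw [smul_smul]; exact hv _ }
  have hVH : ∀ v ∈ V, v ∈ H := fun v hv => by simpa using hv 1
  refine ⟨V, hVH, ?_⟩
  by_contra! hcon
  choose h hH' hlt hV using fun k : ℕ => hcon (1 / ((k : ℝ) + 1)) (by positivity)
  let x : ℕ → E := fun k => h k - V.starProjection (h k)
  have hx : ∀ k, x k ∈ H := fun k =>
    H.sub_mem (hH' k) (hVH _ (V.starProjection_apply_mem _))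
  have hx0 : ∀ k, x k ≠ 0 := fun k h0 => hV k (by
    rw [sub_eq_zero.1 h0]; exact V.starProjection_apply_mem _)
  have hlim : Tendsto x atTop (𝓝 0) :=
    squeeze_zero_norm (fun k => (hlt k).le) tendsto_one_div_add_atTop_nhds_zero_nat
  obtain ⟨a, φ, ha, hφ, hline⟩ := exists_line_of_tendsto_zero hH hx hx0 hlim
  have haV : a ∈ V := hline
  have haO : a ∈ Vᗮ := V.isClosed_orthogonal.mem_of_tendsto hφ
    (Eventually.of_forall fun k => Vᗮ.smul_mem _ (V.sub_starProjection_mem_orthogonal _))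
  have : a = 0 := by
    have := V.inner_right_of_mem_orthogonal haV haO
    exact inner_self_eq_zero.1 this
  simp [this] at ha

theorem norm_sub_starProjection_le (V : Submodule ℝ E) (x : E) :
    ‖x - V.starProjection x‖ ≤ ‖x‖ := by
  rw [← Submodule.starProjection_orthogonal_val]
  exact Submodule.norm_starProjection_apply_le _ _

theorem HasGap.exists_basis {H : AddSubgroup E} (hH : HasGap H) :
    ∃ (n : ℕ) (e : Fin n → E), LinearIndependent ℝ e ∧
      ∀ x, x ∈ H ↔ ∃ k : Fin n → ℤ, x = ∑ i, k i • e i := by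
  obtain ⟨ε, hε, hgap⟩ := hH
  let L : Submodule ℤ E := AddSubgroup.toIntSubmodule H
  have hdisc : DiscreteTopology L := by
    refine discreteTopology_of_isOpen_singleton_zero ?_
    rw [Metric.isOpen_singleton_iff]
    exact ⟨ε, hε, fun y hy => Subtype.ext (hgap y y.2 (by simpa using hy))⟩
  let b₀ := Module.Free.chooseBasis ℤ L
  obtain ⟨n, ⟨b⟩⟩ : ∃ n, Nonempty (Module.Basis (Fin n) ℤ L) :=
    ⟨_, ⟨b₀.reindex (Fintype.equivFin _)⟩⟩
  let e : Fin n → E := fun i => (b i : E)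
  have hspan : Submodule.span ℤ (Set.range e) = L := by
    have : Set.range e = L.subtype '' Set.range b := by
      rw [← Set.range_comp]; rfl
    rw [this, ← Submodule.map_span, b.span_eq, Submodule.map_top, Submodule.range_subtype]
  have hLI : LinearIndependent ℤ e :=
    b.linearIndependent.map' L.subtype (Submodule.ker_subtype _)
  refine ⟨n, e, ?_, fun x => ?_⟩
  -- Discreteness is what upgrades independence over ℤ to independence over ℝ.
  · rw [linearIndependent_iff_card_eq_finrank_span, Real.finrank_eq_int_finrank_of_discrete
      (by rw [hspan]; exact hdisc)]
    exact linearIndependent_iff_card_eq_finrank_span.1 hLI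
  · have : x ∈ H ↔ x ∈ Submodule.span ℤ (Set.range e) := by rw [hspan]; rfl
    rw [this, Submodule.mem_span_range_iff_exists_fun]
    exact ⟨fun ⟨c, hc⟩ => ⟨c, hc.symm⟩, fun ⟨c, hc⟩ => ⟨c, hc.symm⟩⟩

/-- The f j are the Riesz representatives of the coordinate functionals on the span of e. -/
theorem exists_dual_family {n : ℕ} {e : Fin n → E} (he : LinearIndependent ℝ e) :
    ∃ f : Fin n → E, (∀ i j, inner ℝ (e i) (f j) = if i = j then (1 : ℝ) else 0) ∧
      ∀ t ∈ Submodule.span ℝ (Set.range e), t = ∑ j, (inner ℝ t (f j) : ℝ) • e j := by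
  let W := Submodule.span ℝ (Set.range e)
  let b : Module.Basis (Fin n) ℝ W := Module.Basis.span he
  have hb : ∀ i, (b i : E) = e i := fun i =>
    congrArg Subtype.val (Module.Basis.span_apply he i)
  let f : Fin n → E := fun j =>
    (((InnerProductSpace.toDual ℝ W).symm (LinearMap.toContinuousLinearMap (b.coord j)) : W) : E)
  have hf : ∀ (w : W) j, inner ℝ (w : E) (f j) = b.repr w j := fun w j => by
    have : inner ℝ ((InnerProductSpace.toDual ℝ W).symm
        (LinearMap.toContinuousLinearMap (b.coord j))) w = b.coord j w := by
      rw [InnerProductSpace.toDual_symm_apply]; rfl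
    rw [real_inner_comm]
    exact this
  refine ⟨f, fun i j => ?_, fun t ht => ?_⟩
  · rw [← hb, hf, b.repr_self, Finsupp.single_apply]
  · have := congrArg (Subtype.val) (b.sum_repr ⟨t, ht⟩)
    simp only [AddSubmonoidClass.coe_finsetSum, Submodule.coe_smul, hb] at this
    rw [← this]
    refine Finset.sum_congr rfl fun j _ => ?_
    rw [this]
    exact congrArg (· • e j) (hf ⟨t, ht⟩ j).symm

/-- G itself need not be discrete, so in general one generator u is added to L. Let V be the
subspace of G that isolates it. If V meets L, u is a half of an element of L up to scaling: doubling
sends the new group into L, so half of the gap survives. If V misses L but is nonzero, any nonzero u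
in V works, because short elements of G lie in V and hence have no L-part. If V = 0, G is already
discrete. -/
theorem HasGap.exists_between {L G : AddSubgroup E} (hL : HasGap L) (hG : IsClosed (G : Set E))
    (hLG : L < G) : ∃ H : AddSubgroup E, HasGap H ∧ L < H ∧ H ≤ G := by
  obtain ⟨V, hVG, ε, hε, hV⟩ := exists_subspace_of_isClosed hG
  have key : ∀ u ∈ G, u ∉ L → HasGap (L ⊔ AddSubgroup.zmultiples u) →
      ∃ H : AddSubgroup E, HasGap H ∧ L < H ∧ H ≤ G := fun u hu huL hgap => by
    refine ⟨_, hgap, lt_of_le_of_ne le_sup_left fun heq => huL ?_,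
      sup_le hLG.le (by simpa using hu)⟩
    rw [heq]
    exact AddSubgroup.mem_sup_right (AddSubgroup.mem_zmultiples u)
  by_cases h1 : ∃ v ∈ V, v ∈ L ∧ v ≠ 0
  · obtain ⟨v, hvV, hvL, hv0⟩ := h1
    obtain ⟨c, hc, hc2⟩ := hL.exists_half hvL hv0
    refine key _ (hVG _ (V.smul_mem c hvV)) hc ?_
    obtain ⟨δ, hδ, hgap⟩ := hL
    refine ⟨δ / 2, by positivity, fun x hx hlt => ?_⟩
    obtain ⟨l, hl, y, hy, rfl⟩ := AddSubgroup.mem_sup.1 hx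
    obtain ⟨m, rfl⟩ := AddSubgroup.mem_zmultiples_iff.1 hy
    have h2 : (2 : ℝ) • (l + m • c • v) ∈ L := by
      rw [smul_add, smul_comm (2 : ℝ) m]
      refine L.add_mem ?_ (L.zsmul_mem hc2 m)
      rw [two_smul]; exact L.add_mem hl hl
    have := hgap _ h2 (by rw [norm_smul]; norm_num; linarith)
    exact (smul_eq_zero.1 this).resolve_left two_ne_zero
  · push Not at h1
    by_cases h2 : ∃ a ∈ V, a ≠ 0
    · obtain ⟨a, haV, ha0⟩ := h2
      refine key a (hVG a haV) (fun haL => ha0 (h1 a haV haL)) ?_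
      refine ⟨min ε ‖a‖, lt_min hε (norm_pos_iff.2 ha0), fun x hx hlt => ?_⟩
      have hxG : x ∈ G := (sup_le hLG.le (by simpa using hVG a haV) :
        L ⊔ AddSubgroup.zmultiples a ≤ G) hx
      have hxV := hV x hxG ((norm_sub_starProjection_le V x).trans_lt
        (hlt.trans_le (min_le_left _ _)))
      obtain ⟨l, hl, y, hy, rfl⟩ := AddSubgroup.mem_sup.1 hx
      obtain ⟨m, rfl⟩ := AddSubgroup.mem_zmultiples_iff.1 hy
      have hmV : m • a ∈ V := zsmul_mem haV m
      have hl0 : l = 0 := h1 l (by simpa using V.sub_mem hxV hmV) hl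
      have hlt2 := hlt.trans_le (min_le_right _ _)
      rw [hl0, zero_add] at hlt2 ⊢
      exact zsmul_eq_zero_of_norm_lt hlt2
    · push Not at h2
      exact ⟨G, ⟨ε, hε, fun x hx hlt => h2 x (hV x hx
        ((norm_sub_starProjection_le V x).trans_lt hlt))⟩, hLG, le_rfl⟩

end Geometry

/-! ### Duality for closed subgroups of the plane -/

section Dual

theorem mem_dualSubgroup {H : AddSubgroup Plane} {s : Plane} :
    s ∈ dualSubgroup H ↔ ∀ t ∈ H, ∃ k : ℤ, inner ℝ s t = 2 * Real.pi * k := Iff.rfl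

theorem dualSubgroup_anti {H K : AddSubgroup Plane} (h : H ≤ K) :
    dualSubgroup K ≤ dualSubgroup H := fun _ hs t ht => hs t (h ht)

theorem le_dualSubgroup_dualSubgroup (H : AddSubgroup Plane) :
    H ≤ dualSubgroup (dualSubgroup H) := fun s hs t ht => by
  rw [real_inner_comm]; exact ht s hs

theorem isClosed_dualSubgroup (H : AddSubgroup Plane) :
    IsClosed (dualSubgroup H : Set Plane) := by
  have h : (dualSubgroup H : Set Plane) = ⋂ t ∈ H, (fun s : Plane => inner ℝ s t) ⁻¹'
      (AddSubgroup.zmultiples (2 * Real.pi) : Set ℝ) := by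
    ext s
    simp only [SetLike.mem_coe, mem_dualSubgroup, Set.mem_iInter, Set.mem_preimage,
      AddSubgroup.mem_zmultiples_iff, zsmul_eq_mul]
    exact forall₂_congr fun t _ => exists_congr fun k => by rw [mul_comm, eq_comm]
  rw [h]
  exact isClosed_biInter fun t _ => (AddSubgroup.isClosed_of_discrete).preimage (by fun_prop)

theorem inner_eq_zero_of_forall_smul {a s : Plane}
    (h : ∀ c : ℝ, ∃ k : ℤ, inner ℝ (c • a) s = 2 * Real.pi * k) : inner ℝ a s = 0 := by
  by_contra h0
  -- This scaling makes the inner product equal to π, which is not a multiple of 2π.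
  obtain ⟨k, hk⟩ := h (Real.pi / inner ℝ a s)
  rw [real_inner_smul_left, div_mul_cancel₀ _ h0] at hk
  have : (1 : ℝ) = 2 * k := by
    have := Real.pi_ne_zero
    field_simp at hk
    linarith
  have : (1 : ℤ) = 2 * k := by exact_mod_cast this
  omega

/-- Without a gap the closed group S* would contain a line, whose direction would be orthogonal to
the spanning set S. -/
theorem hasGap_dualSubgroup {S : AddSubgroup Plane}
    (hS : Submodule.span ℝ (S : Set Plane) = ⊤) : HasGap (dualSubgroup S) := by
  unfold HasGap
  by_contra! hcon
  choose x hx hlt hx0 using fun k : ℕ => hcon (1 / ((k : ℝ) + 1)) (by positivity)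
  obtain ⟨a, -, ha, -, hline⟩ := exists_line_of_tendsto_zero (isClosed_dualSubgroup S) hx hx0
    (squeeze_zero_norm (fun k => (hlt k).le) tendsto_one_div_add_atTop_nhds_zero_nat)
  have h0 : ∀ s ∈ (S : Set Plane), inner ℝ a s = 0 := fun s hs =>
    inner_eq_zero_of_forall_smul fun c => hline c s hs
  have : a ∈ (Submodule.span ℝ (S : Set Plane))ᗮ := by
    rw [Submodule.mem_orthogonal']
    intro u hu
    induction hu using Submodule.span_induction with
    | mem s hs => exact h0 s hs
    | zero => simp
    | add x y _ _ hx hy => rw [inner_add_right, hx, hy, add_zero]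
    | smul c x _ hx => rw [real_inner_smul_right, hx, mul_zero]
  rw [hS, Submodule.top_orthogonal_eq_bot, Submodule.mem_bot] at this
  simp [this] at ha

/-- Vectors orthogonal to H span lines inside H*, which forces t into the real span of the basis e.
Pairing t with 2π f_j, an element of H*, then shows that its coordinates are integers. -/
theorem HasGap.dualSubgroup_dualSubgroup {H : AddSubgroup Plane} (hH : HasGap H) :
    dualSubgroup (dualSubgroup H) = H := by
  refine le_antisymm (fun t ht => ?_) (le_dualSubgroup_dualSubgroup H)
  obtain ⟨n, e, he, hmem⟩ := hH.exists_basis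
  obtain ⟨f, hf, hrep⟩ := exists_dual_family he
  have hdual : ∀ s : Plane, (∀ i, ∃ k : ℤ, inner ℝ s (e i) = 2 * Real.pi * k) →
      s ∈ dualSubgroup H := fun s hs h hh => by
    obtain ⟨m, rfl⟩ := (hmem h).1 hh
    choose k hk using hs
    refine ⟨∑ i, m i * k i, ?_⟩
    rw [inner_sum]
    push_cast
    rw [Finset.mul_sum]
    refine Finset.sum_congr rfl fun i _ => ?_
    rw [← Int.cast_smul_eq_zsmul ℝ, real_inner_smul_right, hk]
    ring
  have hspan : t ∈ Submodule.span ℝ (Set.range e) := by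
    rw [← Submodule.orthogonal_orthogonal (Submodule.span ℝ (Set.range e)),
      Submodule.mem_orthogonal]
    intro s hs
    refine inner_eq_zero_of_forall_smul fun c => ?_
    rw [real_inner_comm]
    refine ht _ (hdual _ fun i => ⟨0, ?_⟩)
    rw [Submodule.mem_orthogonal'] at hs
    rw [real_inner_smul_left, hs _ (Submodule.subset_span ⟨i, rfl⟩)]
    simp
  have hint : ∀ j, ∃ k : ℤ, (inner ℝ t (f j) : ℝ) = k := fun j => by
    obtain ⟨k, hk⟩ := ht ((2 * Real.pi) • f j) (hdual _ fun i => ⟨if i = j then 1 else 0, by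
      rw [real_inner_smul_left, real_inner_comm, hf]; split_ifs <;> simp⟩)
    rw [real_inner_smul_right] at hk
    exact ⟨k, mul_left_cancel₀ (by positivity) hk⟩
  choose k hk using hint
  refine (hmem t).2 ⟨k, ?_⟩
  conv_lhs => rw [hrep t hspan]
  exact Finset.sum_congr rfl fun j _ => by rw [hk, Int.cast_smul_eq_zsmul]

/-- Splitting off the subspace V of H leaves the discrete group D = H ∩ Vᗮ, to which the previous
case applies. Projection to Vᗮ is self-adjoint, sends H to D and so sends D* to H*; thus the
projection of t lies in D** = D. -/
theorem dualSubgroup_dualSubgroup {H : AddSubgroup Plane} (hH : IsClosed (H : Set Plane)) :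
    dualSubgroup (dualSubgroup H) = H := by
  refine le_antisymm (fun t ht => ?_) (le_dualSubgroup_dualSubgroup H)
  obtain ⟨V, hVH, ε, hε, hV⟩ := exists_subspace_of_isClosed hH
  let D : AddSubgroup Plane := H ⊓ Vᗮ.toAddSubgroup
  have hmemD : ∀ x, x ∈ D ↔ x ∈ H ∧ x ∈ Vᗮ := fun x => Iff.rfl
  have hD : HasGap D := ⟨ε, hε, fun x hx hlt => by
    have hxV := hV x hx.1 ((norm_sub_starProjection_le V x).trans_lt hlt)
    exact inner_self_eq_zero.1 (V.inner_right_of_mem_orthogonal hxV ((hmemD x).1 hx).2)⟩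
  have hw : t - V.starProjection t ∈ dualSubgroup (dualSubgroup D) := fun s hs => by
    have hPs : s - V.starProjection s ∈ dualSubgroup H := fun h hh => by
      have hd : h - V.starProjection h ∈ D := (hmemD _).2
        ⟨H.sub_mem hh (hVH _ (V.starProjection_apply_mem _)),
          V.sub_starProjection_mem_orthogonal _⟩
      obtain ⟨k, hk⟩ := hs _ hd
      refine ⟨k, hk ▸ ?_⟩
      rw [inner_sub_left, inner_sub_right, Submodule.inner_starProjection_left_eq_right]
    obtain ⟨k, hk⟩ := ht _ hPs
    refine ⟨k, hk ▸ ?_⟩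
    rw [inner_sub_left, inner_sub_right, Submodule.inner_starProjection_left_eq_right]
  rw [hD.dualSubgroup_dualSubgroup] at hw
  have := H.add_mem ((hmemD _).1 hw).1 (hVH _ (V.starProjection_apply_mem t))
  simpa using this

theorem exists_mem_dualSubgroup_notMem {S₀ S : AddSubgroup Plane}
    (hS₀ : IsClosed (S₀ : Set Plane)) (hlt : S₀ < S) :
    ∃ t ∈ dualSubgroup S₀, t ∉ dualSubgroup S := by
  by_contra! hcon
  refine hlt.not_ge ((le_dualSubgroup_dualSubgroup S).trans ?_)
  rw [← dualSubgroup_dualSubgroup hS₀]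
  exact dualSubgroup_anti hcon

end Dual

/-! ### The Markov chain, phases, and the action of Q(t) on functions -/

section Chain

variable {X : Type*} [MeasurableSpace X] {P : Kernel (X × Plane) (X × Plane)} [IsMarkovKernel P]
  {π : Measure X}

theorem measurableSet_ae_kernel {α β : Type*} [MeasurableSpace α] [MeasurableSpace β]
    (κ : Kernel α β) {p : β → Prop} (hp : MeasurableSet {z | p z}) :
    MeasurableSet {y | ∀ᵐ z ∂(κ y), p z} := by
  have : {y | ∀ᵐ z ∂(κ y), p z} = (fun y => κ y {z | p z}ᶜ) ⁻¹' {0} := by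
    ext y; simp [ae_iff, Set.compl_def]
  rw [this]
  exact (κ.measurable_coe hp.compl) (measurableSet_singleton 0)

theorem ae_law_succ (ν : Measure (X × Plane)) [IsProbabilityMeasure ν] {p : X × Plane → Prop}
    (hp : MeasurableSet {z | p z}) (n : ℕ) :
    (∀ᵐ ω ∂(law P ν), p (ω (n + 1))) ↔ ∀ᵐ ω ∂(law P ν), ∀ᵐ z ∂(P (ω n)), p z := by
  have h := Kernel.map_frestrictLe_trajMeasure_compProd_eq_map_trajMeasure
    (X := fun _ => X × Plane) (μ₀ := ν) (κ := step P) (a := n)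
  change (law P ν).map _ ⊗ₘ _ = (law P ν).map _ at h
  have hq : MeasurableSet {y : ((i : Finset.Iic n) → X × Plane) × (X × Plane) | p y.2} :=
    measurable_snd hp
  have hm : Measurable (fun x : ℕ → X × Plane =>
      (Preorder.frestrictLe (π := fun _ => X × Plane) n x, x (n + 1))) := by fun_prop
  have h1 : (∀ᵐ ω ∂(law P ν), p (ω (n + 1))) ↔
      ∀ᵐ y ∂((law P ν).map (fun x => (Preorder.frestrictLe n x, x (n + 1)))), p y.2 :=
    (ae_map_iff hm.aemeasurable hq).symm
  rw [h1, ← h, Measure.ae_compProd_iff hq]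
  have h2 : MeasurableSet {y | ∀ᵐ z ∂(step P n y), p z} := measurableSet_ae_kernel (step P n) hp
  exact ae_map_iff (by fun_prop) h2

theorem ae_law_zero (ν : Measure (X × Plane)) [IsProbabilityMeasure ν] {p : X × Plane → Prop}
    (hp : MeasurableSet {z | p z}) :
    (∀ᵐ ω ∂(law P ν), p (ω 0)) ↔ ∀ᵐ z ∂ν, p z := by
  have hq : MeasurableSet {y : (i : Finset.Iic 0) → X × Plane | p (y ⟨0, by simp⟩)} :=
    measurable_pi_apply _ hp
  have hm : Measurable (Preorder.frestrictLe (π := fun _ => X × Plane) 0) := by fun_prop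
  have h1 : (∀ᵐ ω ∂(law P ν), p (ω 0)) ↔
      ∀ᵐ y ∂((law P ν).map (Preorder.frestrictLe 0)),
        p ((y : (i : Finset.Iic 0) → X × Plane) ⟨0, by simp⟩) :=
    (ae_map_iff hm.aemeasurable hq).symm
  have h2 : (law P ν).map (Preorder.frestrictLe 0) =
      ν.map (MeasurableEquiv.piUnique (fun _ : Finset.Iic 0 => X × Plane)).symm := by
    unfold law Kernel.trajMeasure
    rw [Measure.map_comp _ _ (by fun_prop), Kernel.traj_map_frestrictLe,
      Kernel.partialTraj_self, Measure.id_comp]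
  rw [h1, h2]
  exact ae_map_iff (by fun_prop) hq

theorem ae_lawFrom_zero (x : X) {p : X × Plane → Prop} (hp : MeasurableSet {z | p z}) :
    (∀ᵐ ω ∂(lawFrom P x), p (ω 0)) ↔ p (x, 0) := by
  unfold lawFrom
  rw [ae_law_zero _ hp, ae_dirac_iff hp]

theorem ae_lawFrom_one (x : X) {p : X × Plane → Prop} (hp : MeasurableSet {z | p z}) :
    (∀ᵐ ω ∂(lawFrom P x), p (ω 1)) ↔ ∀ᵐ z ∂(P (x, 0)), p z := by
  unfold lawFrom
  rw [ae_law_succ _ hp 0, ae_law_zero _ (measurableSet_ae_kernel P hp),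
    ae_dirac_iff (measurableSet_ae_kernel P hp)]

theorem IsAdditive.apply_eq_map (hP : IsAdditive P) (x : X) (s : Plane) :
    P (x, s) = (P (x, 0)).map (fun z => (z.1, z.2 + s)) := by
  refine Measure.ext_prod fun {A B} hA hB => ?_
  rw [hP x s A B hA hB, Measure.map_apply (by fun_prop) (hA.prod hB)]
  rfl

theorem IsAdditive.ae_iff (hP : IsAdditive P) (x : X) (s : Plane) {p : X × Plane → Prop}
    (hp : MeasurableSet {z | p z}) :
    (∀ᵐ z ∂(P (x, s)), p z) ↔ ∀ᵐ z ∂(P (x, 0)), p (z.1, z.2 + s) := by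
  rw [hP.apply_eq_map]
  exact ae_map_iff (by fun_prop) hp

theorem driveKernel_apply (x : X) : driveKernel P x = (P (x, 0)).map Prod.fst := by
  unfold driveKernel
  rw [Kernel.map_apply _ measurable_fst, Kernel.comap_apply]

instance : IsMarkovKernel (driveKernel P) := by
  unfold driveKernel
  exact Kernel.IsMarkovKernel.map _ measurable_fst

theorem ae_driveKernel_of_ae (hπ : (driveKernel P).Invariant π) {p : X → Prop}
    (hp : ∀ᵐ x ∂π, p x) : ∀ᵐ x ∂π, ∀ᵐ y ∂(driveKernel P x), p y := by
  rw [← hπ.def] at hp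
  exact Measure.ae_ae_of_ae_bind (Kernel.aemeasurable _) hp

theorem ae_kernel_of_ae (hπ : (driveKernel P).Invariant π) {p : X → Prop}
    (hp : ∀ᵐ x ∂π, p x) : ∀ᵐ x ∂π, ∀ᵐ z ∂(P (x, 0)), p z.1 := by
  filter_upwards [ae_driveKernel_of_ae hπ hp] with x hx
  rw [driveKernel_apply] at hx
  exact ae_of_ae_map measurable_fst.aemeasurable hx

/-- By invariance the set of points from which the next step almost surely lands in A has full
measure too; the induction passes from A to that set. -/
theorem ae_drive_mem (hP : IsAdditive P) (hπ : (driveKernel P).Invariant π) (n : ℕ) :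
    ∀ {A : Set X}, MeasurableSet A → (∀ᵐ x ∂π, x ∈ A) →
      ∀ᵐ x ∂π, ∀ᵐ ω ∂(lawFrom P x), drive n ω ∈ A := by
  induction n with
  | zero =>
    intro A hA h
    filter_upwards [h] with x hx
    exact (ae_lawFrom_zero x (p := fun z => z.1 ∈ A) (measurable_fst hA)).2 hx
  | succ n ih =>
    intro A hA h
    have hA1 : MeasurableSet {z : X × Plane | z.1 ∈ A} := measurable_fst hA
    have hA2 : MeasurableSet {y : X | ∀ᵐ z ∂(P (y, 0)), z.1 ∈ A} :=
      (show Measurable (fun y : X => (y, (0 : Plane))) by fun_prop) (measurableSet_ae_kernel P hA1)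
    filter_upwards [ih hA2 (ae_kernel_of_ae hπ h)] with x hx
    refine (ae_law_succ _ hA1 n).2 ?_
    filter_upwards [hx] with ω hω
    exact (hP.ae_iff (ω n).1 (ω n).2 hA1).2 hω

variable (P π) in
/-- The measurable function `w` of modulus one satisfies `exp(i⟨t,S₁⟩) w(X₁) = l w(X₀)`. -/
def IsPhase (t : Plane) (l : ℂ) (w : X → ℂ) : Prop :=
  Measurable w ∧ ‖l‖ = 1 ∧ ∀ᵐ x ∂π, ‖w x‖ = 1 ∧
    ∀ᵐ z ∂(P (x, 0)), Complex.exp (Complex.I * (inner ℝ t z.2 : ℝ)) * w z.1 = l * w x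

theorem measurableSet_phase (t : Plane) {w : X → ℂ} (hw : Measurable w) (c : ℂ) :
    MeasurableSet {z : X × Plane |
      Complex.exp (Complex.I * (inner ℝ t z.2 : ℝ)) * w z.1 = c} :=
  measurableSet_eq_fun (by fun_prop) measurable_const

theorem isPhase_of_ae_lawFrom {t : Plane} {l : ℂ} {w : X → ℂ} (hw : Measurable w) (hl : ‖l‖ = 1)
    (h : ∀ᵐ x ∂π, ‖w x‖ = 1 ∧ ∀ n : ℕ, 1 ≤ n → ∀ᵐ ω ∂(lawFrom P x),
      Complex.exp (Complex.I * (inner ℝ t (walk n ω) : ℝ)) * w (drive n ω) = l ^ n * w x) :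
    IsPhase P π t l w := by
  refine ⟨hw, hl, ?_⟩
  filter_upwards [h] with x hx
  refine ⟨hx.1, (ae_lawFrom_one x (measurableSet_phase t hw _)).1 ?_⟩
  simpa [walk, drive] using hx.2 1 le_rfl

theorem IsPhase.ae_lawFrom (hP : IsAdditive P) (hπ : (driveKernel P).Invariant π) {t : Plane}
    {l : ℂ} {w : X → ℂ} (h : IsPhase P π t l w) :
    ∀ᵐ x ∂π, ‖w x‖ = 1 ∧ ∀ n : ℕ, ∀ᵐ ω ∂(lawFrom P x),
      Complex.exp (Complex.I * (inner ℝ t (walk n ω) : ℝ)) * w (drive n ω) = l ^ n * w x := by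
  obtain ⟨hw, -, hae⟩ := h
  -- The exceptional set is enlarged to a measurable null set, so that the chain can be kept out of
  -- it at all times and the one-step relation applied at each X_n.
  obtain ⟨A, hAsub, hAm, hA0⟩ := exists_measurable_superset_of_null (ae_iff.1 hae)
  have hA : ∀ᵐ x ∂π, x ∈ Aᶜ := by simpa [ae_iff] using hA0
  have hdrive := ae_all_iff.2 fun n => ae_drive_mem hP hπ n hAm.compl hA
  filter_upwards [hae, hdrive] with x hx hxd
  refine ⟨hx.1, fun n => ?_⟩
  induction n with
  | zero =>
    refine (ae_lawFrom_zero x (measurableSet_phase t hw _)).2 ?_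
    simp
  | succ n ih =>
    refine (ae_law_succ _ (measurableSet_phase t hw _) n).2 ?_
    filter_upwards [ih, hxd n] with ω hω hd
    have hstep := (not_not.1 fun hn => hd (hAsub hn)).2
    refine (hP.ae_iff (ω n).1 (ω n).2 (measurableSet_phase t hw _)).2 ?_
    filter_upwards [hstep] with z hz
    rw [inner_add_right, Complex.ofReal_add, mul_add, Complex.exp_add, mul_right_comm, hz,
      pow_succ', mul_assoc, mul_assoc l, ← hω, mul_comm (w (drive n ω))]
    rfl

theorem isPhase_one : IsPhase P π 0 1 (fun _ => 1) :=
  ⟨measurable_const, by simp, by simp⟩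

theorem IsPhase.mul {t t' : Plane} {l l' : ℂ} {w w' : X → ℂ} (h : IsPhase P π t l w)
    (h' : IsPhase P π t' l' w') : IsPhase P π (t + t') (l * l') (fun x => w x * w' x) := by
  refine ⟨h.1.mul h'.1, by simp [h.2.1, h'.2.1], ?_⟩
  filter_upwards [h.2.2, h'.2.2] with x hx hx'
  refine ⟨by simp [hx.1, hx'.1], ?_⟩
  filter_upwards [hx.2, hx'.2] with z hz hz'
  rw [inner_add_left, Complex.ofReal_add, mul_add, Complex.exp_add,
    mul_mul_mul_comm, hz, hz', mul_mul_mul_comm]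

theorem IsPhase.conj {t : Plane} {l : ℂ} {w : X → ℂ} (h : IsPhase P π t l w) :
    IsPhase P π (-t) (starRingEnd ℂ l) (fun x => starRingEnd ℂ (w x)) := by
  refine ⟨Complex.continuous_conj.measurable.comp h.1, by simp [h.2.1], ?_⟩
  filter_upwards [h.2.2] with x hx
  refine ⟨by simp [hx.1], ?_⟩
  filter_upwards [hx.2] with z hz
  rw [← map_mul, ← hz, map_mul, ← Complex.exp_conj]
  simp

variable (P π) in
/-- The frequencies `t` that admit a measurable phase. -/
def phaseGroup : AddSubgroup Plane where
  carrier := {t | ∃ l w, IsPhase P π t l w}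
  zero_mem' := ⟨_, _, isPhase_one⟩
  add_mem' := fun ⟨_, _, h⟩ ⟨_, _, h'⟩ => ⟨_, _, h.mul h'⟩
  neg_mem' := fun ⟨_, _, h⟩ => ⟨_, _, h.conj⟩

theorem IsPhase.const_mul {t : Plane} {l c : ℂ} {w : X → ℂ} (h : IsPhase P π t l w)
    (hc : ‖c‖ = 1) : IsPhase P π t l (fun x => c * w x) := by
  refine ⟨h.1.const_mul c, h.2.1, ?_⟩
  filter_upwards [h.2.2] with x hx
  refine ⟨by simp [hx.1, hc], ?_⟩
  filter_upwards [hx.2] with z hz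
  rw [mul_left_comm, hz, mul_left_comm]

theorem IsPhase.fourierFun_eq {t : Plane} {l : ℂ} {w : X → ℂ} (h : IsPhase P π t l w) :
    fourierFun P t w =ᵐ[π] fun x => l * w x := by
  filter_upwards [h.2.2] with x hx
  unfold fourierFun
  rw [integral_congr_ae hx.2]
  simp

theorem norm_fourier_integrand (t : Plane) (f : X → ℂ) (z : X × Plane) :
    ‖Complex.exp (Complex.I * (inner ℝ t z.2 : ℝ)) * f z.1‖ = ‖f z.1‖ := by
  rw [norm_mul, mul_comm Complex.I, Complex.norm_exp_ofReal_mul_I, one_mul]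

theorem isPhase_of_fourierFun_eq (hπ : (driveKernel P).Invariant π) {t : Plane} {l : ℂ}
    {w : X → ℂ} (hw : Measurable w) (hl : ‖l‖ = 1) (hw1 : ∀ᵐ x ∂π, ‖w x‖ = 1)
    (h : fourierFun P t w =ᵐ[π] fun x => l * w x) : IsPhase P π t l w := by
  refine ⟨hw, hl, ?_⟩
  filter_upwards [hw1, h, ae_kernel_of_ae hπ hw1] with x hx1 hx2 hx3
  refine ⟨hx1, ?_⟩
  have hle : ∀ᵐ z ∂(P (x, 0)),
      ‖Complex.exp (Complex.I * (inner ℝ t z.2 : ℝ)) * w z.1‖ ≤ 1 := by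
    filter_upwards [hx3] with z hz
    rw [norm_fourier_integrand, hz]
  have hav : fourierFun P t w x = ⨍ z, Complex.exp (Complex.I * (inner ℝ t z.2 : ℝ)) * w z.1
      ∂(P (x, 0)) := (average_eq_integral _ _).symm
  -- Strict convexity of the disc: an average of values in the closed unit disc has modulus one only
  -- if the values are almost surely constant.
  rcases ae_eq_const_or_norm_average_lt_of_norm_le_const hle with h1 | h1
  · rw [← hav, hx2] at h1
    exact h1
  · rw [← hav, hx2, norm_mul, hl, hx1] at h1
    norm_num at h1

theorem lintegral_driveKernel (x : X) {u : X → ℝ≥0∞} (hu : Measurable u) :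
    ∫⁻ y, u y ∂(driveKernel P x) = ∫⁻ z, u z.1 ∂(P (x, 0)) := by
  rw [driveKernel_apply, lintegral_map hu measurable_fst]

theorem lintegral_lintegral_driveKernel (hπ : (driveKernel P).Invariant π) {u : X → ℝ≥0∞}
    (hu : Measurable u) : ∫⁻ x, ∫⁻ y, u y ∂(driveKernel P x) ∂π = ∫⁻ x, u x ∂π := by
  conv_rhs => rw [← hπ.def]
  rw [Measure.lintegral_bind (Kernel.aemeasurable _) hu.aemeasurable]

theorem enorm_fourierFun_le (t : Plane) {f : X → ℂ} (hf : Measurable f) (x : X) :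
    ‖fourierFun P t f x‖ₑ ≤ ∫⁻ y, ‖f y‖ₑ ∂(driveKernel P x) := by
  rw [lintegral_driveKernel x hf.enorm]
  refine (enorm_integral_le_lintegral_enorm _).trans_eq (lintegral_congr fun z => ?_)
  rw [← ofReal_norm, norm_fourier_integrand, ofReal_norm]

theorem ae_integrable_driveKernel (hπ : (driveKernel P).Invariant π) {f : X → ℂ}
    (hf : Measurable f) (hfi : Integrable f π) :
    ∀ᵐ x ∂π, Integrable f (driveKernel P x) := by
  have h : ∫⁻ x, ∫⁻ y, ‖f y‖ₑ ∂(driveKernel P x) ∂π ≠ ∞ := by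
    rw [lintegral_lintegral_driveKernel hπ hf.enorm]
    exact hfi.2.ne
  filter_upwards [ae_lt_top (hf.enorm.lintegral_kernel) h] with x hx
  exact ⟨hf.aestronglyMeasurable, hx⟩

theorem integrable_fourier_integrand {t : Plane} {f : X → ℂ} {x : X} (hf : Measurable f)
    (h : Integrable f (driveKernel P x)) :
    Integrable (fun z : X × Plane => Complex.exp (Complex.I * (inner ℝ t z.2 : ℝ)) * f z.1)
      (P (x, 0)) := by
  rw [driveKernel_apply] at h
  have h' : Integrable (fun z : X × Plane => f z.1) (P (x, 0)) :=
    (integrable_map_measure hf.aestronglyMeasurable measurable_fst.aemeasurable).1 h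
  refine h'.mono (by fun_prop) (Eventually.of_forall fun z => ?_)
  rw [norm_fourier_integrand]

/-- Since l w = Q(t) w, the left integrand is |Q(t)(f − w)|, which is at most Q|f − w|; invariance
of π removes Q. -/
theorem lintegral_sub_phase_le (hπ : (driveKernel P).Invariant π) [IsProbabilityMeasure π]
    {t : Plane} {l : ℂ} {w f g : X → ℂ} (h : IsPhase P π t l w) (hf : Measurable f)
    (hfi : Integrable f π) (hg : g =ᵐ[π] fourierFun P t f) :
    ∫⁻ x, ‖g x - l * w x‖ₑ ∂π ≤ ∫⁻ x, ‖f x - w x‖ₑ ∂π := by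
  have hwi : Integrable w π := by
    refine Integrable.of_bound h.1.aestronglyMeasurable 1 ?_
    filter_upwards [h.2.2] with x hx using hx.1.le
  refine (lintegral_mono_ae ?_).trans_eq (lintegral_lintegral_driveKernel hπ (hf.sub h.1).enorm)
  filter_upwards [hg, h.fourierFun_eq, ae_integrable_driveKernel hπ hf hfi,
    ae_integrable_driveKernel hπ h.1 hwi] with x hx1 hx2 hx3 hx4
  rw [hx1, ← hx2]
  refine le_trans (le_of_eq ?_) (enorm_fourierFun_le t (hf.sub h.1) x)
  unfold fourierFun
  rw [← integral_sub (integrable_fourier_integrand hf hx3) (integrable_fourier_integrand h.1 hx4)]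
  simp [mul_sub]

/-- An equality or inequality modulo the given sense is preserved by integration
against `Q(x, ·)`. -/
theorem eventually_driveKernel_ae (hπ : (driveKernel P).Invariant π) {s : Filter X}
    (hs : s = ⊤ ∨ s = ae π) {p : X → Prop} (hp : ∀ᶠ x in s, p x) :
    ∀ᶠ x in s, ∀ᵐ y ∂(driveKernel P x), p y := by
  rcases hs with rfl | rfl
  · rw [eventually_top] at hp ⊢
    exact fun x => Eventually.of_forall hp
  · exact ae_driveKernel_of_ae hπ hp

theorem fourierFun_congr (hπ : (driveKernel P).Invariant π) {s : Filter X}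
    (hs : s = ⊤ ∨ s = ae π) (t : Plane) {f g : X → ℂ} (h : f =ᶠ[s] g) :
    fourierFun P t f =ᶠ[s] fourierFun P t g := by
  filter_upwards [eventually_driveKernel_ae hπ hs h] with x hx
  rw [driveKernel_apply] at hx
  refine integral_congr_ae ?_
  filter_upwards [ae_of_ae_map measurable_fst.aemeasurable hx] with z hz
  rw [hz]

/-- Positivity of Q iterates the one-step inequality into the form required by `A4`. -/
theorem le_kernelPow (hπ : (driveKernel P).Invariant π) {s : Filter X}
    (hs : s = ⊤ ∨ s = ae π) {c : ℝ≥0∞} {u : X → ℝ≥0∞} (hu : Measurable u)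
    (h : ∀ᶠ x in s, c * u x ≤ ∫⁻ y, u y ∂(driveKernel P x)) (n : ℕ) :
    ∀ᶠ x in s, c ^ n * u x ≤ kernelPow (driveKernel P) n u x := by
  induction n with
  | zero => exact Eventually.of_forall fun x => by simp [kernelPow]
  | succ n ih =>
    filter_upwards [h, eventually_driveKernel_ae hπ hs ih] with x hx hx'
    unfold kernelPow
    rw [Function.iterate_succ_apply', pow_succ, mul_assoc]
    calc c ^ n * (c * u x) ≤ c ^ n * ∫⁻ y, u y ∂(driveKernel P x) := by gcongr
      _ = ∫⁻ y, c ^ n * u y ∂(driveKernel P x) := (lintegral_const_mul _ hu).symm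
      _ ≤ _ := lintegral_mono_ae hx'

end Chain

/-! ### Spectral theory of a single operator -/

section Operators

variable {Y : Type*} [NormedAddCommGroup Y] [NormedSpace ℂ Y]

open Polynomial in
-- Apply the factors one at a time: the last nonzero vector before annihilation is an eigenvector.
theorem exists_eigenvector_of_multiset_prod (A : Module.End ℂ Y) (s : Multiset ℂ) :
    ∀ f : Y, f ≠ 0 → (aeval A (s.map fun c => X - C c).prod) f = 0 →
      ∃ μ ∈ s, ∃ g : Y, g ≠ 0 ∧ A g = μ • g := by
  induction s using Multiset.induction with
  | empty => intro f hf h; simp [hf] at h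
  | cons c s ih =>
    intro f hf h
    rw [Multiset.map_cons, Multiset.prod_cons, map_mul, Module.End.mul_apply] at h
    by_cases h0 : (aeval A (s.map fun c => X - C c).prod) f = 0
    · obtain ⟨μ, hμ, g, hg⟩ := ih f hf h0
      exact ⟨μ, Multiset.mem_cons_of_mem hμ, g, hg⟩
    · refine ⟨c, Multiset.mem_cons_self c s, _, h0, ?_⟩
      rw [map_sub, aeval_X, aeval_C, LinearMap.sub_apply, Module.algebraMap_end_apply] at h
      exact sub_eq_zero.1 h

open Polynomial in
-- All roots of X^n − c^n have modulus |c|. The eigenvalue found may differ from c, but only its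
-- modulus matters later.
theorem exists_eigenvector_of_pow {A : Y →L[ℂ] Y} {n : ℕ} (hn : n ≠ 0) {c : ℂ} {f : Y}
    (hf : f ≠ 0) (h : (A ^ n) f = c ^ n • f) :
    ∃ μ : ℂ, ‖μ‖ = ‖c‖ ∧ ∃ g : Y, g ≠ 0 ∧ A g = μ • g := by
  let p : ℂ[X] := X ^ n - C (c ^ n)
  have hmonic : p.Monic := monic_X_pow_sub_C _ hn
  have hp : p = (p.roots.map fun a => X - C a).prod :=
    (IsAlgClosed.splits p).eq_prod_roots_of_monic hmonic
  have h0 : (aeval (A : Module.End ℂ Y) p) f = 0 := by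
    have h1 : ((A : Module.End ℂ Y) ^ n) f = c ^ n • f := by
      rw [← h, ← ContinuousLinearMap.toLinearMap_pow]; rfl
    rw [map_sub, map_pow, aeval_X, aeval_C, LinearMap.sub_apply, h1, Module.algebraMap_end_apply,
      sub_self]
  rw [hp] at h0
  obtain ⟨μ, hμ, g, hg0, hg⟩ := exists_eigenvector_of_multiset_prod _ _ f hf h0
  refine ⟨μ, ?_, g, hg0, hg⟩
  have hroot : μ ^ n = c ^ n := by
    have := (mem_roots hmonic.ne_zero).1 hμ
    simpa [p, sub_eq_zero] using this
  have : ‖μ‖ ^ n = ‖c‖ ^ n := by rw [← norm_pow, hroot, norm_pow]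
  exact (pow_left_inj₀ (norm_nonneg _) (norm_nonneg _) hn).1 this

theorem exists_compact_norm_sub_lt_one {A : Y →L[ℂ] Y} (h : essSpectralRadius A < 1) :
    ∃ (n : ℕ) (K : Y →L[ℂ] Y), n ≠ 0 ∧ IsCompactOperator K ∧ ‖A ^ n - K‖ < 1 := by
  have h1 := eventually_lt_of_limsup_lt h
  obtain ⟨n, hn, hn1⟩ := (h1.and (eventually_ge_atTop 1)).exists
  have hlt : (⨅ K : {K : Y →L[ℂ] Y // IsCompactOperator K}, ‖A ^ n - K.1‖ₑ) < 1 := by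
    by_contra! hge
    exact hn.not_ge (ENNReal.one_le_rpow hge (by positivity))
  obtain ⟨K, hK⟩ := iInf_lt_iff.1 hlt
  refine ⟨n, K.1, by omega, K.2, ?_⟩
  rw [← ofReal_norm, ← ENNReal.ofReal_one, ENNReal.ofReal_lt_ofReal_iff one_pos] at hK
  exact hK

variable [CompleteSpace Y]

/-- Points of the spectrum outside the open unit disc come from eigenvectors if the essential
spectral radius is less than one. -/
theorem exists_eigenvector_of_mem_spectrum {A : Y →L[ℂ] Y} (h : essSpectralRadius A < 1) {c : ℂ}
    (hc : c ∈ spectrum ℂ A) (hc1 : 1 ≤ ‖c‖) :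
    ∃ μ : ℂ, ‖μ‖ = ‖c‖ ∧ ∃ g : Y, g ≠ 0 ∧ A g = μ • g := by
  obtain ⟨n, K, hn, hK, hlt⟩ := exists_compact_norm_sub_lt_one h
  have : Nontrivial Y := by
    by_contra hY
    rw [not_nontrivial_iff_subsingleton] at hY
    rw [spectrum.mem_iff] at hc
    exact hc (isUnit_of_subsingleton _)
  have hcn : c ^ n ∈ spectrum ℂ (A ^ n) := spectrum.pow_mem_pow A n hc
  have hD : c ^ n ∈ resolventSet ℂ (A ^ n - K) := by
    refine spectrum.mem_resolventSet_of_norm_lt ?_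
    rw [norm_pow]
    exact hlt.trans_le (one_le_pow₀ hc1)
  obtain ⟨U, hU⟩ := hD
  -- Here U = c^n − (A^n − K) is invertible because ‖A^n − K‖ < 1 ≤ |c^n|. The question is thereby
  -- reduced to the Fredholm alternative at 1 for the compact operator U⁻¹K.
  have hfac : algebraMap ℂ (Y →L[ℂ] Y) (c ^ n) - A ^ n =
      U * (1 - (↑U⁻¹ : Y →L[ℂ] Y) * K) := by
    rw [mul_sub, mul_one, ← mul_assoc, Units.mul_inv, one_mul, hU]
    abel
  have hK' : IsCompactOperator ((↑U⁻¹ : Y →L[ℂ] Y) * K) := hK.clm_comp _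
  rcases hK'.hasEigenvalue_or_mem_resolventSet one_ne_zero with he | hr
  · obtain ⟨f, hf⟩ := he.exists_hasEigenvector
    have hf1 : ((↑U⁻¹ : Y →L[ℂ] Y) * K) f = f := by
      have := hf.apply_eq_smul
      rwa [one_smul] at this
    have h0 : (algebraMap ℂ (Y →L[ℂ] Y) (c ^ n) - A ^ n) f = 0 := by
      rw [hfac, mul_apply_eq_comp, sub_apply, hf1]
      simp
    refine exists_eigenvector_of_pow hn hf.2 ?_
    rw [sub_apply, sub_eq_zero] at h0
    rw [← h0, ContinuousLinearMap.algebraMap_apply]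
  · refine absurd ?_ hcn
    rw [resolventSet, Set.mem_ofPred_eq] at hr
    rw [map_one] at hr
    show IsUnit _
    rw [hfac]
    exact U.isUnit.mul hr

theorem tendsto_pow_of_spectralRadius_lt_one {A : Y →L[ℂ] Y} (h : spectralRadius ℂ A < 1) :
    Tendsto (fun n : ℕ => ‖A ^ n‖) atTop (𝓝 0) := by
  obtain ⟨q, hq1, hq2⟩ := ENNReal.lt_iff_exists_nnreal_btwn.1 h
  have hq2' : (q : ℝ) < 1 := by exact_mod_cast hq2
  have hev := (spectrum.pow_nnnorm_pow_one_div_tendsto_nhds_spectralRadius A).eventually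
    (gt_mem_nhds hq1)
  refine squeeze_zero' (Eventually.of_forall fun _ => norm_nonneg _) ?_
    (tendsto_pow_atTop_nhds_zero_of_lt_one q.2 hq2')
  filter_upwards [hev, eventually_ge_atTop 1] with n hn hn1
  have h1 : (‖A ^ n‖₊ : ℝ≥0∞) ≤ (q : ℝ≥0∞) ^ n := by
    have := ENNReal.rpow_le_rpow hn.le (Nat.cast_nonneg n : (0 : ℝ) ≤ n)
    rwa [← ENNReal.rpow_mul, one_div, inv_mul_cancel₀ (by positivity), ENNReal.rpow_one,
      ENNReal.rpow_natCast] at this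
  exact_mod_cast h1

theorem spectralRadius_lt_one_of_norm_pow_lt_one [Nontrivial Y] {A : Y →L[ℂ] Y} {n : ℕ}
    (hn : n ≠ 0) (h : ‖A ^ n‖ < 1) : spectralRadius ℂ A < 1 := by
  have h1 := (spectrum.spectralRadius_pow_le A n hn).trans
    (spectrum.spectralRadius_le_nnnorm (𝕜 := ℂ) (A ^ n))
  have h2 : (‖A ^ n‖₊ : ℝ≥0∞) < 1 := by exact_mod_cast h
  by_contra! hge
  exact (h1.trans_lt h2).not_ge (one_le_pow₀ hge)

/-- With n = Nq + r the norm is at most M 2^(-q). The rate is ρ = 2^(-1/N), and the factor 2 pays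
for ρ^r ≥ 1/2. -/
theorem norm_pow_le_of_norm_pow_le_half {A : Y →L[ℂ] Y} {N : ℕ} (hN : N ≠ 0) {M : ℝ}
    (hM : ∀ k, ‖A ^ k‖ ≤ M) (h : ‖A ^ N‖ ≤ 1 / 2) (n : ℕ) :
    ‖A ^ n‖ ≤ 2 * M * ((1 / 2 : ℝ) ^ (1 / (N : ℝ))) ^ n := by
  set ρ : ℝ := (1 / 2 : ℝ) ^ (1 / (N : ℝ)) with hρ
  have hρ0 : 0 ≤ ρ := by positivity
  have hρ1 : ρ ≤ 1 := Real.rpow_le_one (by norm_num) (by norm_num) (by positivity)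
  have hρN : ρ ^ N = 1 / 2 := by
    rw [hρ, one_div (N : ℝ), Real.rpow_inv_natCast_pow (by norm_num) hN]
  have hM0 : 0 ≤ M := (norm_nonneg _).trans (hM 0)
  have hq : ∀ q r : ℕ, ‖A ^ (N * q + r)‖ ≤ M * (1 / 2) ^ q := fun q r => by
    induction q with
    | zero => simpa using hM r
    | succ q ih =>
      have : N * (q + 1) + r = N + (N * q + r) := by ring
      rw [this, pow_add]
      calc ‖A ^ N * A ^ (N * q + r)‖ ≤ ‖A ^ N‖ * ‖A ^ (N * q + r)‖ := norm_mul_le _ _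
        _ ≤ 1 / 2 * (M * (1 / 2) ^ q) := by gcongr
        _ = _ := by ring
  have hn := Nat.div_add_mod n N
  have h1 := hq (n / N) (n % N)
  rw [hn] at h1
  have h2 : (1 / 2 : ℝ) ≤ ρ ^ (n % N) := by
    rw [← hρN]
    exact pow_le_pow_of_le_one hρ0 hρ1 (Nat.mod_lt _ (Nat.pos_of_ne_zero hN)).le
  have h3 : ρ ^ n = (1 / 2) ^ (n / N) * ρ ^ (n % N) := by
    conv_lhs => rw [← hn, pow_add, pow_mul, hρN]
  rw [h3]
  have h4 : 0 ≤ M * (1 / 2) ^ (n / N) := by positivity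
  nlinarith

end Operators

/-! ### Local uniformity in t of exponential decay -/

section Perturbation

variable {B : Type*} [NormedAddCommGroup B] [NormedSpace ℂ B]
  {Bh : Type*} [NormedAddCommGroup Bh] [NormedSpace ℂ Bh]
  {J : B →L[ℂ] Bh} {T : Plane → B →L[ℂ] B} {Th : Plane → Bh →L[ℂ] Bh}

theorem exists_uniform_bounds (h3 : A3 J T) {K : Set Plane} (hK : IsCompact K) :
    ∃ κ C M : ℝ, 0 < κ ∧ κ < 1 ∧ 0 < C ∧ 0 < M ∧ ∀ t ∈ K, (∀ n, ‖T t ^ n‖ ≤ M) ∧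
      ∀ n : ℕ, 1 ≤ n → ∀ f : B, ‖(T t ^ n) f‖ ≤ C * κ ^ n * ‖f‖ + C * ‖J f‖ := by
  obtain ⟨κ, C, hκ0, hκ1, hC, h⟩ := h3 K hK
  -- The summand 1 covers n = 0, where the Doeblin-Fortet inequality is not available.
  refine ⟨κ, C, 1 + C + C * ‖J‖, hκ0, hκ1, hC, by positivity, fun t ht => ⟨fun n => ?_, (h t ht).2⟩⟩
  refine ContinuousLinearMap.opNorm_le_bound _ (by positivity) fun f => ?_
  rcases Nat.eq_zero_or_pos n with rfl | hn
  · rw [pow_zero, one_apply_eq_self]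
    have : 0 ≤ (C + C * ‖J‖) * ‖f‖ := by positivity
    linarith
  · have h1 := (h t ht).2 n hn f
    have h2 : C * κ ^ n * ‖f‖ ≤ C * 1 * ‖f‖ := by
      gcongr
      exact pow_le_one₀ hκ0.le hκ1.le
    have h3 : C * ‖J f‖ ≤ C * (‖J‖ * ‖f‖) := by
      gcongr
      exact J.le_opNorm f
    nlinarith [norm_nonneg f]

theorem tendsto_norm_comp_pow_sub (hcomm : ∀ t f, J (T t f) = Th t (J f)) (h2 : A2 J T)
    (h3 : A3 J T) (t₀ : Plane) (m : ℕ) :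
    Tendsto (fun t => ‖J ∘L (T t ^ m - T t₀ ^ m)‖) (𝓝 t₀) (𝓝 0) := by
  obtain ⟨κ, C, M, -, -, -, hM0, h⟩ := exists_uniform_bounds h3 (isCompact_closedBall t₀ 1)
  induction m with
  | zero => simp
  | succ m ih =>
    have hA2 : Tendsto (fun t => ‖J ∘L (T t - T t₀)‖) (𝓝 t₀) (𝓝 0) := by
      have h0 : Tendsto (fun t => t - t₀) (𝓝 t₀) (𝓝 0) := by
        exact tendsto_sub_nhds_zero_iff.2 tendsto_id
      simpa [Function.comp_def] using (h2 t₀).comp h0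
    refine squeeze_zero' (Eventually.of_forall fun _ => norm_nonneg _) ?_
      (by simpa only [zero_mul, mul_zero, add_zero] using
        (hA2.mul_const M).add (ih.const_mul ‖Th t₀‖))
    filter_upwards [Metric.closedBall_mem_nhds t₀ one_pos] with t ht
    -- Telescoping: (A2) controls the first term, while in the second J is moved past Q(t₀) by means
    -- of its action on the larger space.
    have heq : J ∘L (T t ^ (m + 1) - T t₀ ^ (m + 1)) =
        (J ∘L (T t - T t₀)) ∘L (T t ^ m) + Th t₀ ∘L (J ∘L (T t ^ m - T t₀ ^ m)) := by
      ext f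
      simp [pow_succ', hcomm]
    rw [heq]
    refine (norm_add_le _ _).trans (add_le_add ?_ (ContinuousLinearMap.opNorm_comp_le _ _))
    refine (ContinuousLinearMap.opNorm_comp_le _ _).trans ?_
    gcongr
    exact (h t ht).1 m

/-- Continuity of Q(t) holds only into the weaker norm, so the Doeblin-Fortet inequality is applied
to the vector Q(t)^m f. First n makes the strong term small, then m makes Q(t₀)^m small, then t is
taken so near t₀ that Q(t)^m is close to Q(t₀)^m in the weak norm. The three contributions of 1/8
keep ‖Q(t)^(n+m)‖ below 1/2. -/
theorem exists_nhds_norm_pow_le [CompleteSpace B] (hcomm : ∀ t f, J (T t f) = Th t (J f))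
    (h2 : A2 J T) (h3 : A3 J T) {t₀ : Plane} (hr : spectralRadius ℂ (T t₀) < 1) :
    ∃ U ∈ 𝓝 t₀, ∃ ρ : ℝ, 0 ≤ ρ ∧ ρ < 1 ∧ ∃ C : ℝ, ∀ n : ℕ, ∀ t ∈ U, ‖T t ^ n‖ ≤ C * ρ ^ n := by
  obtain ⟨κ, C, M, hκ0, hκ1, hC, hM0, h⟩ :=
    exists_uniform_bounds h3 (isCompact_closedBall t₀ 1)
  have hlim1 : Tendsto (fun n : ℕ => C * κ ^ n * M) atTop (𝓝 0) := by
    simpa using ((tendsto_pow_atTop_nhds_zero_of_lt_one hκ0.le hκ1).const_mul C).mul_const M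
  obtain ⟨n, hn, hn1⟩ := ((hlim1.eventually (gt_mem_nhds (show (0 : ℝ) < 1 / 8 by norm_num))).and
    (eventually_ge_atTop 1)).exists
  have hlim2 : Tendsto (fun m : ℕ => C * (‖J‖ * ‖T t₀ ^ m‖)) atTop (𝓝 0) := by
    simpa using ((tendsto_pow_of_spectralRadius_lt_one hr).const_mul ‖J‖).const_mul C
  obtain ⟨m, hm⟩ := (hlim2.eventually (gt_mem_nhds (show (0 : ℝ) < 1 / 8 by norm_num))).exists
  have hlim3 : Tendsto (fun t => C * ‖J ∘L (T t ^ m - T t₀ ^ m)‖) (𝓝 t₀) (𝓝 0) := by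
    simpa using (tendsto_norm_comp_pow_sub hcomm h2 h3 t₀ m).const_mul C
  have hU := hlim3.eventually (gt_mem_nhds (show (0 : ℝ) < 1 / 8 by norm_num))
  refine ⟨_, inter_mem (Metric.closedBall_mem_nhds t₀ one_pos) hU,
    (1 / 2 : ℝ) ^ (1 / ((n + m : ℕ) : ℝ)), by positivity,
    Real.rpow_lt_one (by norm_num) (by norm_num) (by positivity), 2 * M, ?_⟩
  rintro k t ⟨htK, htU⟩
  refine norm_pow_le_of_norm_pow_le_half (by omega) (h t htK).1 ?_ k
  refine ContinuousLinearMap.opNorm_le_bound _ (by norm_num) fun f => ?_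
  rw [pow_add, mul_apply_eq_comp]
  have e1 := (h t htK).2 n hn1 ((T t ^ m) f)
  have e2 : ‖(T t ^ m) f‖ ≤ M * ‖f‖ := ContinuousLinearMap.le_of_opNorm_le _ ((h t htK).1 m) f
  have e3 : ‖J ((T t ^ m) f)‖ ≤ ‖J ∘L (T t ^ m - T t₀ ^ m)‖ * ‖f‖ + ‖J‖ * ‖T t₀ ^ m‖ * ‖f‖ := by
    have : J ((T t ^ m) f) = (J ∘L (T t ^ m - T t₀ ^ m)) f + J ((T t₀ ^ m) f) := by simp
    rw [this]
    refine (norm_add_le _ _).trans (add_le_add (ContinuousLinearMap.le_opNorm _ _) ?_)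
    refine (J.le_opNorm _).trans ?_
    rw [mul_assoc]
    gcongr
    exact ContinuousLinearMap.le_opNorm _ _
  have e4 : C * κ ^ n * ‖(T t ^ m) f‖ ≤ C * κ ^ n * (M * ‖f‖) := by gcongr
  have e5 := mul_le_mul_of_nonneg_left e3 hC.le
  have hf := norm_nonneg f
  have e6 := mul_le_mul_of_nonneg_right hn.le hf
  have e7 := mul_le_mul_of_nonneg_right hm.le hf
  have e8 := mul_le_mul_of_nonneg_right (show C * ‖J ∘L (T t ^ m - T t₀ ^ m)‖ ≤ 1 / 8 from
    le_of_lt htU) hf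
  nlinarith

end Perturbation

/-! ### The dichotomy between spectral radius below one and phases -/

section Spaces

variable {X : Type*} [MeasurableSpace X] {P : Kernel (X × Plane) (X × Plane)} [IsMarkovKernel P]
  {π : Measure X} [IsProbabilityMeasure π]
  {B : Type*} [NormedAddCommGroup B] [NormedSpace ℂ B]
  {Bh : Type*} [NormedAddCommGroup Bh] [NormedSpace ℂ Bh]
  {F : FunctionSpace π B} {Fh : FunctionSpace π Bh} {J : B →L[ℂ] Bh}
  {T : Plane → B →L[ℂ] B} {Th : Plane → Bh →L[ℂ] Bh}

theorem FunctionSpace.ae_le_sense (F : FunctionSpace π B) : ae π ≤ F.sense := by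
  rcases F.sense_eq with h | h <;> rw [h]
  exact le_top

theorem FunctionSpace.rep_zero (F : FunctionSpace π B) : F.rep 0 =ᶠ[F.sense] 0 := by
  simpa using F.rep_smul 0 0

theorem FunctionSpace.IsInclusion.comm (hπ : (driveKernel P).Invariant π)
    (hJ : F.IsInclusion Fh J) (hT : ∀ t, F.IsFourierOperator P t (T t))
    (hTh : ∀ t, Fh.IsFourierOperator P t (Th t)) (t : Plane) (f : B) :
    J (T t f) = Th t (J f) := by
  apply Fh.rep_injective
  have h1 : F.rep (T t f) =ᶠ[Fh.sense] fourierFun P t (F.rep f) := hJ.1 (hT t f).2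
  exact ((hJ.2 _).trans h1).trans
    ((hTh t (J f)).2.trans (fourierFun_congr hπ Fh.sense_eq t (hJ.2 f))).symm

/-- The bound |f| ≤ π(|f|) from (A4) has equal integrals on both sides, so |f| is almost everywhere
constant; dividing by that constant normalizes f. -/
theorem exists_unimodular_eigenvector (hπ : (driveKernel P).Invariant π) (h4 : A4 F P) {t : Plane}
    {A : B →L[ℂ] B} (hA : F.IsFourierOperator P t A) {μ : ℂ} (hμ : 1 ≤ ‖μ‖) {f : B} (hf : f ≠ 0)
    (hAf : A f = μ • f) :
    ‖μ‖ = 1 ∧ ∃ w : B, A w = μ • w ∧ ∀ᵐ x ∂π, ‖F.rep w x‖ = 1 := by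
  have hone : ∀ᶠ x in F.sense, ‖μ‖ₑ * ‖F.rep f x‖ₑ ≤ ∫⁻ y, ‖F.rep f y‖ₑ ∂(driveKernel P x) := by
    filter_upwards [(hA f).2, F.rep_smul μ f] with x hx1 hx2
    have : μ * F.rep f x = fourierFun P t (F.rep f) x := by
      rw [← hx1, hAf, hx2]; rfl
    rw [← enorm_mul, this]
    exact enorm_fourierFun_le t (F.measurable_rep f) x
  obtain ⟨hμ1, hle⟩ := h4 μ f hμ hf ⟨0, fun n _ => by
    filter_upwards [le_kernelPow hπ F.sense_eq (F.measurable_rep f).enorm hone n] with x hx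
    rwa [ENNReal.ofReal_mul (by positivity), ENNReal.ofReal_pow (norm_nonneg _), ofReal_norm,
      ofReal_norm]⟩
  refine ⟨hμ1, ?_⟩
  set c : ℝ := ∫ y, ‖F.rep f y‖ ∂π with hc
  -- The bound of (A4) holds in the sense of B, so a zero mean gives f = 0 in B even when B consists
  -- of functions.
  have hc0 : c ≠ 0 := fun h0 => hf (F.rep_injective _ _ (by
    filter_upwards [hle, F.rep_zero] with x hx hx0
    rw [h0] at hx
    rw [hx0, Pi.zero_apply]
    exact norm_le_zero_iff.1 hx))
  have hle' : ∀ᵐ x ∂π, ‖F.rep f x‖ ≤ c := F.ae_le_sense hle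
  have heq : ∀ᵐ x ∂π, ‖F.rep f x‖ = c := by
    have hi : Integrable (fun x => c - ‖F.rep f x‖) π :=
      (integrable_const c).sub (F.integrable_rep f).norm
    have h0 : ∫ x, (c - ‖F.rep f x‖) ∂π = 0 := by
      rw [integral_sub (integrable_const c) (F.integrable_rep f).norm]
      simp [hc]
    have := (integral_eq_zero_iff_of_nonneg_ae (by
      filter_upwards [hle'] with x hx using sub_nonneg.2 hx) hi).1 h0
    filter_upwards [this] with x hx
    exact (sub_eq_zero.1 hx).symm
  refine ⟨((c⁻¹ : ℝ) : ℂ) • f, by rw [map_smul, hAf, smul_comm], ?_⟩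
  filter_upwards [heq, F.ae_le_sense (F.rep_smul ((c⁻¹ : ℝ) : ℂ) f)] with x hx hx2
  have hcpos : 0 ≤ c := integral_nonneg fun _ => norm_nonneg _
  rw [hx2, Pi.smul_apply, norm_smul, hx, Complex.norm_real, norm_inv, Real.norm_of_nonneg hcpos,
    inv_mul_cancel₀ hc0]

theorem A3.essSpectralRadius_lt_one (h3 : A3 J T) (t : Plane) : essSpectralRadius (T t) < 1 := by
  obtain ⟨κ, C, -, hκ, -, h⟩ := h3 {t} isCompact_singleton
  refine (h t rfl).1.trans_lt ?_
  rwa [ENNReal.ofReal_lt_one]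

/-- A spectral value attaining the spectral radius either lies in the open unit disc or comes with
an eigenvector of eigenvalue of the same modulus, which (A4) forces to be one. -/
theorem spectralRadius_lt_one_or_exists_phase [CompleteSpace B] [Nontrivial B]
    (hπ : (driveKernel P).Invariant π) (h4 : A4 F P) {t : Plane} {A : B →L[ℂ] B}
    (hA : F.IsFourierOperator P t A) (hess : essSpectralRadius A < 1) :
    spectralRadius ℂ A < 1 ∨
      (spectralRadius ℂ A = 1 ∧ ∃ (l : ℂ) (w : B), IsPhase P π t l (F.rep w)) := by
  obtain ⟨c, hc, hcr⟩ := spectrum.exists_nnnorm_eq_spectralRadius A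
  rw [← hcr]
  rcases lt_or_ge ‖c‖ 1 with h | h
  · left
    exact_mod_cast h
  · right
    obtain ⟨μ, hμ, g, hg, hAg⟩ := exists_eigenvector_of_mem_spectrum hess hc h
    obtain ⟨hμ1, w, hw, hw1⟩ := exists_unimodular_eigenvector hπ h4 hA (hμ ▸ h) hg hAg
    refine ⟨?_, μ, w, isPhase_of_fourierFun_eq hπ (F.measurable_rep w) hμ1 hw1 ?_⟩
    · rw [hμ] at hμ1
      have hc1 : ‖c‖₊ = 1 := NNReal.eq hμ1
      rw [hc1, ENNReal.coe_one]
    · filter_upwards [F.ae_le_sense (hA w).2, F.ae_le_sense (F.rep_smul μ w)] with x hx hx2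
      rw [← hx, hw, hx2]
      rfl

theorem exists_lintegral_rep_le (hJ : F.IsInclusion Fh J) (hL1 : Fh.ContinuouslyInL1) :
    ∃ d : ℝ, ∀ f : B, ∫⁻ x, ‖F.rep f x‖ₑ ∂π ≤ ENNReal.ofReal (d * ‖f‖) := by
  obtain ⟨d, hd, h⟩ := hL1
  refine ⟨d * ‖J‖, fun f => ?_⟩
  rw [← ofReal_integral_norm_eq_lintegral_enorm (F.integrable_rep f)]
  refine ENNReal.ofReal_le_ofReal ?_
  have h1 : ∫ x, ‖F.rep f x‖ ∂π = ∫ x, ‖Fh.rep (J f) x‖ ∂π := by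
    refine integral_congr_ae ?_
    filter_upwards [Fh.ae_le_sense (hJ.2 f)] with x hx
    rw [hx]
  rw [h1, mul_assoc]
  exact (h _).trans (by gcongr; exact J.le_opNorm f)

theorem IsPhase.lintegral_rep_pow_sub_le (hπ : (driveKernel P).Invariant π) {t : Plane}
    {A : B →L[ℂ] B} (hA : F.IsFourierOperator P t A) {l : ℂ} {v : X → ℂ}
    (hv : IsPhase P π t l v) (f : B) (n : ℕ) :
    ∫⁻ x, ‖F.rep ((A ^ n) f) x - l ^ n * v x‖ₑ ∂π ≤ ∫⁻ x, ‖F.rep f x - v x‖ₑ ∂π := by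
  induction n with
  | zero => simp
  | succ n ih =>
    refine le_trans ?_ ih
    have hph : IsPhase P π t l (fun x => l ^ n * v x) := hv.const_mul (by simp [hv.2.1])
    have := lintegral_sub_phase_le hπ hph (F.measurable_rep ((A ^ n) f))
      (F.integrable_rep _) (F.ae_le_sense (hA ((A ^ n) f)).2)
    simpa only [pow_succ', mul_assoc, mul_apply_eq_comp] using this

/-- The phase v need not belong to B. As l^n v has L¹-norm one and Q(t)^n f stays within the initial
distance of it, Q(t)^n f would keep a positive L¹-norm, against its convergence to zero in B. -/
theorem IsPhase.not_spectralRadius_lt_one [CompleteSpace B] (hπ : (driveKernel P).Invariant π)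
    (hJ : F.IsInclusion Fh J) (hL1 : Fh.ContinuouslyInL1) {t : Plane} {A : B →L[ℂ] B}
    (hA : F.IsFourierOperator P t A) {l : ℂ} {v : X → ℂ} (hv : IsPhase P π t l v) (f : B)
    (hf : ∫⁻ x, ‖F.rep f x - v x‖ₑ ∂π < 1) : ¬ spectralRadius ℂ A < 1 := by
  intro hr
  obtain ⟨d, hd⟩ := exists_lintegral_rep_le hJ hL1
  have hlim : Tendsto (fun n : ℕ => ENNReal.ofReal (d * ‖(A ^ n) f‖)) atTop (𝓝 0) := by
    have h1 : Tendsto (fun n : ℕ => ‖(A ^ n) f‖) atTop (𝓝 0) :=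
      squeeze_zero (fun _ => norm_nonneg _) (fun n => (A ^ n).le_opNorm f)
        (by simpa using (tendsto_pow_of_spectralRadius_lt_one hr).mul_const ‖f‖)
    simpa using ENNReal.tendsto_ofReal (h1.const_mul d)
  have hbound : ∀ n : ℕ, 1 ≤ ∫⁻ x, ‖F.rep f x - v x‖ₑ ∂π + ENNReal.ofReal (d * ‖(A ^ n) f‖) :=
    fun n => by
      calc (1 : ℝ≥0∞) = ∫⁻ x, ‖l ^ n * v x‖ₑ ∂π := by
            rw [lintegral_congr_ae (g := fun _ => 1) (by
              filter_upwards [hv.2.2] with x hx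
              rw [← ofReal_norm]
              simp [hv.2.1, hx.1])]
            simp
        _ ≤ ∫⁻ x, (‖F.rep ((A ^ n) f) x - l ^ n * v x‖ₑ + ‖F.rep ((A ^ n) f) x‖ₑ) ∂π := by
            refine lintegral_mono fun x => ?_
            conv_lhs => rw [← sub_sub_cancel (F.rep ((A ^ n) f) x) (l ^ n * v x)]
            exact (enorm_sub_le).trans_eq (add_comm _ _)
        _ = ∫⁻ x, ‖F.rep ((A ^ n) f) x - l ^ n * v x‖ₑ ∂π + ∫⁻ x, ‖F.rep ((A ^ n) f) x‖ₑ ∂π :=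
            lintegral_add_right _ (F.measurable_rep _).enorm
        _ ≤ _ := add_le_add (hv.lintegral_rep_pow_sub_le hπ hA f n) (hd _)
  have := ge_of_tendsto' (hlim.const_add (∫⁻ x, ‖F.rep f x - v x‖ₑ ∂π)) hbound
  rw [add_zero] at this
  exact this.not_gt hf

theorem isPhase_of_mem_dualSubgroup {S : AddSubgroup Plane} (hSc : IsClosed (S : Set Plane))
    (hS : ∀ (x : X) (n : ℕ), ∀ᵐ ω ∂(lawFrom P x), walk n ω ∈ S) {t : Plane}
    (ht : t ∈ dualSubgroup S) : IsPhase P π t 1 (fun _ => 1) := by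
  refine ⟨measurable_const, by simp, Eventually.of_forall fun x => ⟨by simp, ?_⟩⟩
  have hm : MeasurableSet {z : X × Plane | z.2 ∈ S} := measurable_snd hSc.measurableSet
  filter_upwards [(ae_lawFrom_one x hm).1 (hS x 1)] with z hz
  obtain ⟨k, hk⟩ := ht _ hz
  rw [hk, mul_one, mul_one, Complex.exp_eq_one_iff]
  exact ⟨k, by push_cast; ring⟩

theorem GeometricDecay.spectralRadius_lt_one [CompleteSpace B] [Nontrivial B]
    {S : AddSubgroup Plane} (h : GeometricDecay T S) {t : Plane} (ht : t ∉ dualSubgroup S) :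
    spectralRadius ℂ (T t) < 1 := by
  obtain ⟨ρ, hρ0, hρ1, C, hC⟩ := h {t} isCompact_singleton (by rintro _ rfl; exact ht)
  have hlim : Tendsto (fun n : ℕ => C * ρ ^ n) atTop (𝓝 0) := by
    simpa using (tendsto_pow_atTop_nhds_zero_of_lt_one hρ0 hρ1).const_mul C
  obtain ⟨n, ⟨hn1, hn2⟩, hn3⟩ := ((hC.and (hlim.eventually (gt_mem_nhds one_pos))).and
    (eventually_ge_atTop 1)).exists
  exact spectralRadius_lt_one_of_norm_pow_lt_one (n := n) (by omega) ((hn1 t rfl).trans_lt hn2)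

theorem geometricDecay_of_forall_spectralRadius_lt_one [CompleteSpace B]
    (hcomm : ∀ t f, J (T t f) = Th t (J f)) (h2 : A2 J T) (h3 : A3 J T) {S : AddSubgroup Plane}
    (h : ∀ t ∉ dualSubgroup S, spectralRadius ℂ (T t) < 1) : GeometricDecay T S := by
  intro K hK hKS
  -- Requiring 0 ≤ C makes the bound monotone in ρ and C, so that it passes to unions of two sets.
  suffices hs : ∃ ρ : ℝ, 0 ≤ ρ ∧ ρ < 1 ∧ ∃ C : ℝ, 0 ≤ C ∧ ∀ n : ℕ, ∀ t ∈ K,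
      ‖T t ^ n‖ ≤ C * ρ ^ n by
    obtain ⟨ρ, h0, h1, C, -, hC⟩ := hs
    exact ⟨ρ, h0, h1, C, Eventually.of_forall hC⟩
  refine hK.induction_on (p := fun K => ∃ ρ : ℝ, 0 ≤ ρ ∧ ρ < 1 ∧ ∃ C : ℝ, 0 ≤ C ∧ ∀ n : ℕ, ∀ t ∈ K,
      ‖T t ^ n‖ ≤ C * ρ ^ n) ?_ ?_ ?_ ?_
  · exact ⟨0, le_rfl, one_pos, 0, le_rfl, by simp⟩
  · rintro K₁ K₂ hsub ⟨ρ, h0, h1, C, hC0, hC⟩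
    exact ⟨ρ, h0, h1, C, hC0, fun n t ht => hC n t (hsub ht)⟩
  · rintro K₁ K₂ ⟨ρ₁, h01, h11, C₁, hC01, hC1⟩ ⟨ρ₂, h02, h12, C₂, hC02, hC2⟩
    refine ⟨max ρ₁ ρ₂, le_max_of_le_left h01, max_lt h11 h12, max C₁ C₂,
      le_max_of_le_left hC01, fun n t ht => ?_⟩
    rcases ht with ht | ht
    · exact (hC1 n t ht).trans (by gcongr <;> exact le_max_left _ _)
    · exact (hC2 n t ht).trans (by gcongr <;> exact le_max_right _ _)
  · intro t ht
    obtain ⟨U, hU, ρ, h0, h1, C, hC⟩ := exists_nhds_norm_pow_le hcomm h2 h3 (h t (hKS t ht))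
    refine ⟨U, mem_nhdsWithin_of_mem_nhds hU, ρ, h0, h1, |C|, abs_nonneg C, fun n s hs =>
      (hC n s hs).trans ?_⟩
    gcongr
    exact le_abs_self C

/-- Away from the group the spectral radius is below one, and this persists nearby. By density any
measurable phase is L¹-approximated within one by an element of B, so no nearby frequency can have a
phase. -/
theorem isClosed_phaseGroup [CompleteSpace B] [Nontrivial B] (hπ : (driveKernel P).Invariant π)
    (hJ : F.IsInclusion Fh J) (hL1 : Fh.ContinuouslyInL1)
    (hT : ∀ t, F.IsFourierOperator P t (T t)) (hcomm : ∀ t f, J (T t f) = Th t (J f))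
    (h2 : A2 J T) (h3 : A3 J T) (h4 : A4 F P) (hdense : F.DenseInL1) :
    IsClosed (phaseGroup P π : Set Plane) := by
  rw [← isOpen_compl_iff, isOpen_iff_mem_nhds]
  intro t₀ ht₀
  have hr : spectralRadius ℂ (T t₀) < 1 :=
    (spectralRadius_lt_one_or_exists_phase hπ h4 (hT t₀) (h3.essSpectralRadius_lt_one t₀)
      ).resolve_right fun ⟨_, l, w, hw⟩ => ht₀ ⟨l, _, hw⟩
  obtain ⟨U, hU, ρ, h0, h1, C, hC⟩ := exists_nhds_norm_pow_le hcomm h2 h3 hr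
  refine mem_of_superset hU fun t htU => ?_
  rintro ⟨l, w, hw⟩
  have hlim : Tendsto (fun n : ℕ => C * ρ ^ n) atTop (𝓝 0) := by
    simpa using (tendsto_pow_atTop_nhds_zero_of_lt_one h0 h1).const_mul C
  obtain ⟨n, hn1, hn2⟩ := ((hlim.eventually (gt_mem_nhds one_pos)).and
    (eventually_ge_atTop 1)).exists
  have hwi : Integrable w π := by
    refine Integrable.of_bound hw.1.aestronglyMeasurable 1 ?_
    filter_upwards [hw.2.2] with x hx using hx.1.le
  obtain ⟨f, hf⟩ := hdense w hwi 1 one_pos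
  refine hw.not_spectralRadius_lt_one hπ hJ hL1 (hT t) f ?_
    (spectralRadius_lt_one_of_norm_pow_lt_one (n := n) (by omega) ((hC n t htU).trans_lt hn1))
  refine (ofReal_integral_norm_eq_lintegral_enorm ((F.integrable_rep f).sub hwi)).symm.trans_lt ?_
  rw [ENNReal.ofReal_lt_one]
  simpa only [Pi.sub_apply, norm_sub_rev] using hf

end Spaces

/-! ### From phases to sublattice data and back -/

section Sublattice

variable {X : Type*} [MeasurableSpace X] {P : Kernel (X × Plane) (X × Plane)} [IsMarkovKernel P]
  {π : Measure X}

theorem exists_int_of_exp_mul_eq {a : ℝ} {l w w' : ℂ} {n : ℕ} (hl : ‖l‖ = 1) (hw : ‖w‖ = 1)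
    (h : Complex.exp (Complex.I * (a : ℝ)) * w' = l ^ n * w) :
    ∃ k : ℤ, a + w'.arg - w.arg = n * l.arg + 2 * Real.pi * k := by
  have hpolar : ∀ z : ℂ, ‖z‖ = 1 → z = Complex.exp (z.arg * Complex.I) := fun z hz => by
    conv_lhs => rw [← Complex.norm_mul_exp_arg_mul_I z, hz, Complex.ofReal_one, one_mul]
  have hw' : ‖w'‖ = 1 := by
    have := congrArg norm h
    rwa [norm_mul, norm_mul, norm_pow, hl, hw, mul_comm Complex.I, Complex.norm_exp_ofReal_mul_I,
      one_mul, one_pow, one_mul] at this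
  rw [hpolar w hw, hpolar w' hw', hpolar l hl, ← Complex.exp_nat_mul, ← Complex.exp_add,
    ← Complex.exp_add, Complex.exp_eq_exp_iff_exists_int] at h
  obtain ⟨k, hk⟩ := h
  refine ⟨k, ?_⟩
  have h2 : ((a + w'.arg : ℝ) : ℂ) * Complex.I =
      ((n * l.arg + w.arg + k * (2 * Real.pi) : ℝ) : ℂ) * Complex.I := by
    push_cast
    linear_combination hk
  have h3 := Complex.ofReal_injective (mul_right_cancel₀ Complex.I_ne_zero h2)
  linarith

/-- Discreteness of H provides a finite basis. Phases chosen for the basis vectors alone determine a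
single bounded χ that serves all t in H, by integer combination of the finitely many relations; and
(H*)* = H says that these t are all that must be treated. -/
theorem exists_isSublatticeTriple (hP : IsAdditive P) (hπ : (driveKernel P).Invariant π)
    {S H : AddSubgroup Plane} (hS : IsClosed (S : Set Plane)) (hgap : HasGap H)
    (hSH : dualSubgroup S < H) (hH : H ≤ phaseGroup P π) :
    ∃ (S₀ : AddSubgroup Plane) (χ : X → Plane) (β : dualSubgroup S₀ → ℝ),
      IsSublatticeTriple P π S S₀ χ β := by
  obtain ⟨N, e, he, hmem⟩ := hgap.exists_basis
  obtain ⟨f, hf, -⟩ := exists_dual_family he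
  have heH : ∀ i, e i ∈ H := fun i => (hmem _).2 ⟨Pi.single i 1, by
    rw [Finset.sum_eq_single i (fun j _ hj => by simp [hj]) (by simp)]
    simp⟩
  choose l w hw using fun i => hH (heH i)
  have hwm : ∀ i, Measurable fun x => (w i x).arg := fun i => Complex.measurable_arg.comp (hw i).1
  -- Duality of e and f makes ⟨e_i, χ⟩ = arg w_i. For t = ∑ k_i e_i the coefficient ⟨t, f_i⟩ is the
  -- integer k_i, so β_t = ∑ k_i arg l_i.
  refine ⟨dualSubgroup H, fun x => ∑ i, (w i x).arg • f i,
    fun t => ∑ i, inner ℝ (t : Plane) (f i) * (l i).arg, isClosed_dualSubgroup H, ?_, ?_, ?_, ?_⟩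
  · refine lt_of_le_of_ne ?_ fun heq => hSH.ne ?_
    · rw [← dualSubgroup_dualSubgroup hS]
      exact dualSubgroup_anti hSH.le
    · rw [← heq, hgap.dualSubgroup_dualSubgroup]
  · exact Finset.measurable_sum _ fun i _ => (hwm i).smul_const _
  · refine ⟨∑ i, Real.pi * ‖f i‖, fun x => (norm_sum_le _ _).trans
      (Finset.sum_le_sum fun i _ => ?_)⟩
    rw [norm_smul]
    gcongr
    exact Complex.abs_arg_le_pi _
  -- Only finitely many null sets are discarded, so the exceptional x do not depend on t.
  · have hall := ae_all_iff.2 fun i => (hw i).ae_lawFrom hP hπ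
    filter_upwards [hall] with x hx t n _
    have htH : (t : Plane) ∈ H := hgap.dualSubgroup_dualSubgroup.le t.2
    obtain ⟨k, hk⟩ := (hmem _).1 htH
    have hinner : ∀ j, (inner ℝ (t : Plane) (f j) : ℝ) = k j := fun j => by
      rw [hk, sum_inner, Finset.sum_eq_single j]
      · rw [← Int.cast_smul_eq_zsmul ℝ, real_inner_smul_left, hf, if_pos rfl, mul_one]
      · intro i _ hij
        rw [← Int.cast_smul_eq_zsmul ℝ, real_inner_smul_left, hf, if_neg hij, mul_zero]
      · simp
    filter_upwards [ae_all_iff.2 fun i => (hx i).2 n] with ω hω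
    choose m hm using fun i => exists_int_of_exp_mul_eq (hw i).2.1 (hx i).1 (hω i)
    refine ⟨∑ i, k i * m i, ?_⟩
    have hwalk : (inner ℝ (t : Plane) (walk n ω) : ℝ) = ∑ i, k i * inner ℝ (e i) (walk n ω) := by
      rw [hk, sum_inner]
      refine Finset.sum_congr rfl fun i _ => ?_
      rw [← Int.cast_smul_eq_zsmul ℝ, real_inner_smul_left]
    simp only [inner_add_right, inner_sub_right, inner_sum, real_inner_smul_right, hinner]
    rw [hwalk]
    push_cast
    rw [Finset.mul_sum, Finset.mul_sum, ← Finset.sum_add_distrib, ← Finset.sum_add_distrib,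
      ← Finset.sum_sub_distrib]
    refine Finset.sum_congr rfl fun i _ => ?_
    linear_combination (k i : ℝ) * hm i

theorem IsSublatticeTriple.isPhase {S S₀ : AddSubgroup Plane} {χ : X → Plane}
    {β : dualSubgroup S₀ → ℝ} (h : IsSublatticeTriple P π S S₀ χ β) (t : dualSubgroup S₀) :
    IsPhase P π t (Complex.exp (Complex.I * (β t : ℝ)))
      (fun x => Complex.exp (Complex.I * (inner ℝ (t : Plane) (χ x) : ℝ))) := by
  obtain ⟨-, -, hχ, -, hae⟩ := h
  have hunit : ∀ a : ℝ, ‖Complex.exp (Complex.I * (a : ℝ))‖ = 1 := fun a => by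
    rw [mul_comm, Complex.norm_exp_ofReal_mul_I]
  refine isPhase_of_ae_lawFrom (by fun_prop) (hunit _) ?_
  filter_upwards [hae] with x hx
  refine ⟨hunit _, fun n hn => ?_⟩
  filter_upwards [hx t n hn] with ω ⟨k, hk⟩
  rw [← Complex.exp_nat_mul, ← Complex.exp_add, ← Complex.exp_add,
    Complex.exp_eq_exp_iff_exists_int]
  refine ⟨k, ?_⟩
  rw [inner_sub_right, inner_add_right] at hk
  have hk' := congrArg (fun r : ℝ => (r : ℂ)) hk
  push_cast at hk'
  linear_combination Complex.I * hk'

theorem dualSubgroup_top : dualSubgroup ⊤ = ⊥ := by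
  refine (AddSubgroup.eq_bot_iff_forall _).2 fun s hs => ?_
  refine (inner_self_eq_zero (𝕜 := ℝ)).1 (inner_eq_zero_of_forall_smul fun c => ?_)
  rw [real_inner_smul_left, ← real_inner_smul_right]
  exact hs _ trivial

end Sublattice

end MRW

end

/-! ### The proposition -/

theorem mainTheorem8 {X : Type*} [MeasurableSpace X]
    (P : Kernel (X × Plane) (X × Plane)) [IsMarkovKernel P] (hP : IsAdditive P)
    (π : Measure X) [IsProbabilityMeasure π] (hπ : (driveKernel P).Invariant π)
    (hint : Integrable (walk 1) (lawInit P π)) (hcentered : ∫ ω, walk 1 ω ∂(lawInit P π) = 0)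
    (S : AddSubgroup Plane) (hSclosed : IsClosed (S : Set Plane))
    (hSdim : Submodule.span ℝ (S : Set Plane) = ⊤)
    (hS : ∀ (x : X) (n : ℕ), ∀ᵐ ω ∂(lawFrom P x), walk n ω ∈ S)
    {B : Type*} [NormedAddCommGroup B] [NormedSpace ℂ B] [CompleteSpace B]
    (F : FunctionSpace π B)
    {Bh : Type*} [NormedAddCommGroup Bh] [NormedSpace ℂ Bh] [CompleteSpace Bh]
    (Fh : FunctionSpace π Bh)
    (J : B →L[ℂ] Bh) (hJ : F.IsInclusion Fh J) (hL1 : Fh.ContinuouslyInL1)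
    (hone : F.Contains (fun _ => 1))
    (T : Plane → B →L[ℂ] B) (hT : ∀ t, F.IsFourierOperator P t (T t))
    (Th : Plane → Bh →L[ℂ] Bh) (hTh : ∀ t, Fh.IsFourierOperator P t (Th t))
    (h1 : A1 F T) (h2 : A2 J T) (h3 : A3 J T) (h4 : A4 F P) :
    ((GeometricDecay T S ↔ {t | spectralRadius ℂ (T t) = 1} = (dualSubgroup S : Set Plane)) ∧
      ({t | spectralRadius ℂ (T t) = 1} = (dualSubgroup S : Set Plane) ↔
        ¬ IsArithmetic F P S)) ∧
    (S = ⊤ ∨ F.DenseInL1 → A5 P π → A6 P π S → GeometricDecay T S) ∧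
    ((∃ (S₀ : AddSubgroup Plane) (χ : X → Plane) (β : dualSubgroup S₀ → ℝ),
        IsSublatticeTriple P π S S₀ χ β ∧
        ∀ t : Plane, F.Contains (fun x => Complex.exp (Complex.I * (inner ℝ t (χ x) : ℝ)))) →
      ¬ GeometricDecay T S) := by
  obtain ⟨one, hone⟩ := hone
  have hone' : F.rep one =ᵐ[π] fun _ => 1 := F.ae_le_sense hone
  have hnt : Nontrivial B := by
    refine nontrivial_of_ne one 0 fun h0 => ?_
    have h1 : (fun _ : X => (1 : ℂ)) =ᵐ[π] 0 :=
      hone'.symm.trans (h0 ▸ F.ae_le_sense F.rep_zero)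
    obtain ⟨x, hx⟩ := h1.exists
    exact one_ne_zero hx
  have hcomm := hJ.comm hπ hT hTh
  have hdich := fun t => spectralRadius_lt_one_or_exists_phase hπ h4 (hT t)
    (h3.essSpectralRadius_lt_one t)
  have hphase : ∀ {t : Plane} {l : ℂ} {v : X → ℂ} (f : B), IsPhase P π t l v →
      F.rep f =ᵐ[π] v → ¬ spectralRadius ℂ (T t) < 1 := fun {t l v} f hv hfv => by
    refine hv.not_spectralRadius_lt_one hπ hJ hL1 (hT t) f ?_
    rw [lintegral_congr_ae (g := fun _ => 0) (by
      filter_upwards [hfv] with x hx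
      simp [hx])]
    simp
  -- On S* the constant 1 is itself a phase lying in B.
  have hdual : ∀ t ∈ dualSubgroup S, spectralRadius ℂ (T t) = 1 := fun t ht =>
    ((hdich t).resolve_left
      (hphase one (isPhase_of_mem_dualSubgroup hSclosed hS ht) hone')).1
  have hG : {t | spectralRadius ℂ (T t) = 1} = (dualSubgroup S : Set Plane) ↔
      ∀ t ∉ dualSubgroup S, spectralRadius ℂ (T t) < 1 := by
    constructor
    · intro heq t ht
      exact (hdich t).resolve_right fun hr => ht (heq.subset hr.1)
    · intro h
      ext t
      refine ⟨fun ht => ?_, hdual t⟩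
      by_contra hn
      exact (h t hn).ne ht
  have hdecay : GeometricDecay T S ↔ ∀ t ∉ dualSubgroup S, spectralRadius ℂ (T t) < 1 :=
    ⟨fun h _ ht => h.spectralRadius_lt_one ht,
      geometricDecay_of_forall_spectralRadius_lt_one hcomm h2 h3⟩
  have harith : IsArithmetic F P S ↔ ¬ ∀ t ∉ dualSubgroup S, spectralRadius ℂ (T t) < 1 := by
    constructor
    · rintro ⟨t, l, w, ht, hl, hw⟩ h
      exact hphase w (isPhase_of_ae_lawFrom (F.measurable_rep w) hl hw) (ae_eq_refl _) (h t ht)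
    · intro h
      push Not at h
      obtain ⟨t, ht, hr⟩ := h
      obtain ⟨-, l, w, hw⟩ := (hdich t).resolve_left hr.not_gt
      refine ⟨t, l, w, ht, hw.2.1, ?_⟩
      filter_upwards [hw.ae_lawFrom hP hπ] with x hx
      exact ⟨hx.1, fun n _ => hx.2 n⟩
  refine ⟨⟨hdecay.trans hG.symm, by rw [hG, harith, not_not]⟩, fun hcase _ hA6 => ?_, ?_⟩
  · rw [hdecay]
    by_contra hcon
    push Not at hcon
    obtain ⟨t₀, ht₀, hr⟩ := hcon
    obtain ⟨-, l, w, hw⟩ := (hdich t₀).resolve_left hr.not_gt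
    have ht₀G : t₀ ∈ phaseGroup P π := ⟨l, _, hw⟩
    suffices hH : ∃ H : AddSubgroup Plane, HasGap H ∧ dualSubgroup S < H ∧ H ≤ phaseGroup P π by
      obtain ⟨H, hgap, hlt, hle⟩ := hH
      exact hA6 (exists_isSublatticeTriple hP hπ hSclosed hgap hlt hle)
    rcases hcase with rfl | hdense
    -- The dual of ℝ² is trivial, so the multiples of t₀ already form a suitable discrete group.
    · have h0 : t₀ ≠ 0 := fun h => ht₀ (h ▸ zero_mem _)
      refine ⟨AddSubgroup.zmultiples t₀, hasGap_zmultiples h0, ?_, by simpa using ht₀G⟩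
      rw [dualSubgroup_top, bot_lt_iff_ne_bot]
      simpa using h0
    · refine (hasGap_dualSubgroup hSdim).exists_between
        (isClosed_phaseGroup hπ hJ hL1 hT hcomm h2 h3 h4 hdense) ?_
      refine lt_of_le_of_ne (fun t ht => ⟨_, _, isPhase_of_mem_dualSubgroup hSclosed hS ht⟩) ?_
      exact fun heq => ht₀ (heq ▸ ht₀G)
  · rintro ⟨S₀, χ, β, htriple, hcont⟩ hd
    obtain ⟨t, ht, htS⟩ := exists_mem_dualSubgroup_notMem htriple.1 htriple.2.1
    obtain ⟨f, hf⟩ := hcont t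
    exact hphase f (htriple.isPhase ⟨t, ht⟩) (F.ae_le_sense hf) (hdecay.1 hd t htS)
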